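/- Let $K$ be a field, let $G$ be a finite simple graph with vertex set $V$, let $R=K[x_v : v\in V]$ with its standard grading, and let $I(G)=(x_ux_v : uv\in E(G))\subseteq R$ be the edge ideal of $G$. For a finitely generated graded $R$-module $M$ with graded Betti numbers $\beta_{i,j}(M)$ (the number of summands $R(-j)$ in homological degree $i$ of the graded minimal free resolution of $M$), let $\operatorname{reg}(M)=\max\{j-i : \beta_{i,j}(M)\neq 0\}$ be its Castelnuovo–Mumford regularity, with $\operatorname{reg}(0)=-\infty$. Then: (i) $\operatorname{reg}(I(G)^2)\le \operatorname{reg}(I(G))+2$. (ii) If $G$ is also bipartite, then $\operatorname{reg}(I(G)^s)\le 2s+\operatorname{reg}(I(G))-2$ for all $s\ge 2$. Moreover, for bipartite $G$, if $a,b$ are integers such that $\operatorname{reg}(I(G)^k)=ak+b$ for all sufficiently large integers $k$ (so that $b=b(I(G))$), then $b\le \operatorname{reg}(I(G))-2$. -/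

import Mathlib

open MvPolynomial

noncomputable section

namespace EdgeIdealPowers

/-- The degree `d` component `R_d` of the polynomial ring `R = K[x_v : v ∈ σ]` with its standard
grading, for every integer `d`; it is zero for negative `d`. -/
def homogeneousPart (σ K : Type*) [Field K] (d : ℤ) : Submodule K (MvPolynomial σ K) :=
  if 0 ≤ d then homogeneousSubmodule σ K d.toNat else ⊥

/-- The degree `j` component of the graded free module `⨁ k, R(-δ k)`, where `R(-a)_j = R_(j-a)`. -/
def twistedFreePart {σ K : Type*} [Field K] {r : ℕ} (δ : Fin r → ℤ) (j : ℤ) :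
    Submodule K (Fin r → MvPolynomial σ K) :=
  Submodule.pi Set.univ fun k => homogeneousPart σ K (j - δ k)

/-- The graded maximal ideal `(x_v : v ∈ σ)` of the polynomial ring. -/
def irrelevantIdeal (σ K : Type*) [Field K] : Ideal (MvPolynomial σ K) :=
  Ideal.span (Set.range X)

/-- A graded minimal free resolution
`⋯ → F 2 → F 1 → F 0 → M → 0`, `F i = ⨁ k, R(-shift i k)`,
of a module `M` over `R = K[x_v : v ∈ σ]` with graded components `ℳ j`, `j ∈ ℤ`.
All `F i` are finitely generated and all maps are homogeneous of degree zero. -/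
structure MinimalGradedFreeResolution {σ K M : Type*} [Field K] [AddCommGroup M]
    [Module (MvPolynomial σ K) M] [Module K M] (ℳ : ℤ → Submodule K M) where
  rank : ℕ → ℕ
  shift : (i : ℕ) → Fin (rank i) → ℤ
  augmentation : (Fin (rank 0) → MvPolynomial σ K) →ₗ[MvPolynomial σ K] M
  differential : (i : ℕ) → (Fin (rank (i + 1)) → MvPolynomial σ K) →ₗ[MvPolynomial σ K]
    (Fin (rank i) → MvPolynomial σ K)
  augmentation_mem : ∀ (j : ℤ), ∀ v ∈ twistedFreePart (K := K) (shift 0) j, augmentation v ∈ ℳ j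
  differential_mem : ∀ (i : ℕ) (j : ℤ), ∀ v ∈ twistedFreePart (K := K) (shift (i + 1)) j,
    differential i v ∈ twistedFreePart (K := K) (shift i) j
  augmentation_surjective : Function.Surjective augmentation
  exact_zero : Function.Exact (differential 0) augmentation
  exact_succ : ∀ i, Function.Exact (differential (i + 1)) (differential i)
  minimal : ∀ i, LinearMap.range (differential i) ≤ irrelevantIdeal σ K • ⊤

/-- The graded Betti number `β_{i,j}`: the number of summands `R(-j)` in homological degree `i`. -/
def MinimalGradedFreeResolution.betti {σ K M : Type*} [Field K] [AddCommGroup M]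
    [Module (MvPolynomial σ K) M] [Module K M] {ℳ : ℤ → Submodule K M}
    (F : MinimalGradedFreeResolution (σ := σ) ℳ) (i : ℕ) (j : ℤ) : ℕ :=
  Fintype.card {k : Fin (F.rank i) // F.shift i k = j}

/-- The Castelnuovo–Mumford regularity `max {j - i | β_{i,j}(M) ≠ 0}` of a graded module,
as a supremum in the extended reals; it is `⊥ = -∞` for `M = 0`. The Betti numbers of a finitely
generated graded module do not depend on the graded minimal free resolution `F`. -/
def moduleRegularity (σ : Type*) {K M : Type*} [Field K] [AddCommGroup M]
    [Module (MvPolynomial σ K) M] [Module K M] (ℳ : ℤ → Submodule K M) : EReal :=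
  sSup {r : EReal | ∃ (F : MinimalGradedFreeResolution (σ := σ) ℳ) (i : ℕ) (j : ℤ),
    F.betti i j ≠ 0 ∧ r = (((j - i : ℤ) : ℝ) : EReal)}

/-- The degree `j` component of an ideal, with the grading inherited from the polynomial ring. -/
def idealPart {σ K : Type*} [Field K] (I : Ideal (MvPolynomial σ K)) (j : ℤ) : Submodule K I :=
  (homogeneousPart σ K j).comap ((Submodule.subtype I).restrictScalars K)

/-- The regularity of a (homogeneous) ideal, as a graded module. -/
def reg {σ K : Type*} [Field K] (I : Ideal (MvPolynomial σ K)) : EReal :=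
  moduleRegularity σ (idealPart I)

/-- The edge ideal `I(G) = (x_u x_v : uv ∈ E(G))` over the field `K`. -/
def edgeIdeal {V : Type*} (K : Type*) [Field K] (G : SimpleGraph V) : Ideal (MvPolynomial V K) :=
  Ideal.span {f | ∃ u v, G.Adj u v ∧ f = X u * X v}

/-- `reg (I ^ k) = a * k + b` for all large `k`, that is, `a = a(I)` and `b = b(I)`. -/
def HasAsymptoticRegularity {σ K : Type*} [Field K] (I : Ideal (MvPolynomial σ K))
    (a b : ℤ) : Prop :=
  ∃ c : ℕ, ∀ k : ℕ, c ≤ k → reg (I ^ k) = (((a * k + b : ℤ) : ℝ) : EReal)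

end EdgeIdealPowers

end

/-! Write I for the edge ideal. The multigraded Betti number of a monomial ideal in homological
degree i and multidegree α is the dimension of the reduced homology, at faces with i vertices, of
its upper Koszul complex in degree α. `MonomialRegLE` states regularity bounds in this form, so that
short exact sequences of ideals become Mayer–Vietoris arguments (`MonomialRegLE.of_colon`,
`MonomialRegLE.inter`). Koszul homology and dimension shifting along a minimal resolution translate
back to `reg` (`reg_le_iff_monomialRegLE`).

If the generators m of I^s are split off one at a time in lexicographic order, every colon ideal
that occurs is I^(s+1) : m plus some variables, and adding variables does not raise a regularity
bound that is at least 1. Hence reg I^(s+1) is bounded by reg I^s and the numbers reg (I^(s+1) : m)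
+ 2s (`MonomialRegLE.edgePowerSet_succ`), and it remains to show reg (I^(s+1) : m) ≤ reg I.

For s = 1 and m = ab, the colon is I plus all products uv with u in N(a) and v in N(b). After the
common neighbours are adjoined as variables it becomes the intersection of I : a and I : b, so
Mayer–Vietoris applies (`MonomialRegLE.colon_edge`). The decisive gain is that I plus the variables
in N(a) and N(b) has regularity at most reg I - 1, because the edge ab can be split off as a
disjoint summand (`MonomialRegLE.edge_union_neighbors`).

If G is bipartite, I^2 : ab is the edge ideal of a bipartite graph G', and I^(s+2) : (n·ab) =
I(G')^(s+1) : n (`monomialColon_edgePowerSet_neighborJoin`). Induction on s, with G' in place of G,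
reduces every s to the case s = 1. For the asymptotic claim, I^k has generators of degree 2k, which
forces a ≥ 2; the upper bound at one large k then bounds b. -/

noncomputable section

namespace EdgeIdealPowers

/-! ### Interior and exterior multiplication, and the Koszul differential -/

section KoszulOperators

variable {V : Type*} [LinearOrder V]

/-- The sign of moving the vertex `v` into its place in the face `τ`. -/
def faceSign (v : V) (τ : Finset V) : ℤ := (-1) ^ (τ.filter (· < v)).card

theorem faceSign_mul_self (v : V) (τ : Finset V) : faceSign v τ * faceSign v τ = 1 := by
  rw [faceSign, ← mul_pow]; simp

theorem faceSign_insert {v w : V} {τ : Finset V} (hw : w ∉ τ) :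
    faceSign v (insert w τ) = (if w < v then -1 else 1) * faceSign v τ := by
  unfold faceSign
  rw [Finset.filter_insert]
  split_ifs with h
  · rw [Finset.card_insert_of_notMem (by simp [hw]), pow_succ]; ring
  · simp

theorem faceSign_insert_self {v : V} {τ : Finset V} :
    faceSign v (insert v τ) = faceSign v τ := by
  unfold faceSign
  rw [Finset.filter_insert]; simp

theorem faceSign_swap {v w : V} {τ : Finset V} (hv : v ∉ τ) (hw : w ∉ τ) (hvw : v ≠ w) :
    faceSign v τ * faceSign w (insert v τ) = - (faceSign w τ * faceSign v (insert w τ)) := by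
  rw [faceSign_insert hv, faceSign_insert hw]
  rcases lt_or_gt_of_ne hvw with h | h
  · simp [h, h.not_gt]; ring
  · simp [h, h.not_gt]; ring

variable (R : Type*) {M : Type*} [CommRing R] [AddCommGroup M] [Module R M]

/-- Contraction of a chain by the vertex `v`. -/
def contract (v : V) : (Finset V → M) →ₗ[R] (Finset V → M) where
  toFun c τ := if v ∈ τ then 0 else faceSign v τ • c (insert v τ)
  map_add' c c' := by ext τ; by_cases h : v ∈ τ <;> simp [h]
  map_smul' a c := by
    ext τ; by_cases h : v ∈ τ
    · simp [h]
    · simp [h, smul_comm a (faceSign v τ)]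

/-- The cone over a chain with apex `v`. -/
def wedge (v : V) : (Finset V → M) →ₗ[R] (Finset V → M) where
  toFun c τ := if v ∈ τ then faceSign v τ • c (τ.erase v) else 0
  map_add' c c' := by ext τ; by_cases h : v ∈ τ <;> simp [h]
  map_smul' a c := by
    ext τ; by_cases h : v ∈ τ
    · simp [h, smul_comm a (faceSign v τ)]
    · simp [h]

variable {R}

theorem contract_apply (v : V) (c : Finset V → M) (τ : Finset V) :
    contract R v c τ = if v ∈ τ then 0 else faceSign v τ • c (insert v τ) := rfl

theorem wedge_apply (v : V) (c : Finset V → M) (τ : Finset V) :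
    wedge R v c τ = if v ∈ τ then faceSign v τ • c (τ.erase v) else 0 := rfl

theorem contract_contract_self (v : V) (c : Finset V → M) :
    contract R v (contract R v c) = 0 := by
  ext τ; simp [contract_apply]

theorem contract_comm {v w : V} (h : v ≠ w) (c : Finset V → M) :
    contract R v (contract R w c) = - contract R w (contract R v c) := by
  ext τ
  by_cases hv : v ∈ τ
  · simp [contract_apply, hv]
  by_cases hw : w ∈ τ
  · simp [contract_apply, hw]
  simp only [contract_apply, hv, hw, if_false, Finset.mem_insert, h, h.symm, or_self, Pi.neg_apply,
    ← mul_smul, faceSign_swap hv hw h, neg_smul, Finset.insert_comm v w]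

/-- The Clifford relation between interior and exterior multiplication. Together with
`contract_wedge` it yields the homotopy formula `koszul_wedge`. -/
theorem contract_wedge_self (v : V) (c : Finset V → M) :
    contract R v (wedge R v c) + wedge R v (contract R v c) = c := by
  ext τ
  by_cases hv : v ∈ τ
  · have : faceSign v (τ.erase v) = faceSign v τ := by
      conv_rhs => rw [← Finset.insert_erase hv, faceSign_insert_self]
    simp [contract_apply, wedge_apply, hv, ← mul_smul, this, faceSign_mul_self]
  · simp [contract_apply, wedge_apply, hv, ← mul_smul, faceSign_insert_self, faceSign_mul_self]

theorem contract_wedge {v w : V} (h : v ≠ w) (c : Finset V → M) :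
    contract R v (wedge R w c) = - wedge R w (contract R v c) := by
  ext τ
  by_cases hv : v ∈ τ
  · by_cases hw : w ∈ τ <;> simp [contract_apply, wedge_apply, hv, hw, h]
  by_cases hw : w ∈ τ
  · obtain ⟨σ, hσ, rfl⟩ : ∃ σ, w ∉ σ ∧ τ = insert w σ :=
      ⟨τ.erase w, by simp, (Finset.insert_erase hw).symm⟩
    have hvσ : v ∉ σ := fun h' => hv (Finset.mem_insert_of_mem h')
    have e : (insert v (insert w σ)).erase w = insert v σ := by
      rw [Finset.insert_comm, Finset.erase_insert (by simp [hσ, h.symm])]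
    have e2 := faceSign_swap hσ hvσ h.symm
    simp only [contract_apply, wedge_apply, hv, if_false, Finset.mem_insert, true_or, or_true,
      if_true, e, Finset.erase_insert hσ, hvσ, Pi.neg_apply, ← mul_smul, ← neg_smul]
    congr 1
    rw [Finset.insert_comm, faceSign_insert_self, faceSign_insert_self]
    have a := faceSign_mul_self w σ
    have b := faceSign_mul_self w (insert v σ)
    linear_combination faceSign w σ * faceSign w (insert v σ) * e2 -
      faceSign v (insert w σ) * faceSign w (insert v σ) * a - faceSign w σ * faceSign v σ * b
  · simp [contract_apply, wedge_apply, hv, hw, h.symm]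

variable [Fintype V]

/-- The Koszul differential of the sequence `x`. -/
def koszul (x : V → R) : (Finset V → M) →ₗ[R] (Finset V → M) := ∑ v, x v • contract R v

theorem koszul_eq (x : V → R) (c : Finset V → M) :
    koszul x c = ∑ v, x v • contract R v c := by simp [koszul]

theorem koszul_apply (x : V → R) (c : Finset V → M) (τ : Finset V) :
    koszul x c τ = ∑ v, x v • contract R v c τ := by simp [koszul]

theorem contract_koszul (x : V → R) (v : V) (c : Finset V → M) :
    contract R v (koszul x c) = - koszul x (contract R v c) := by
  rw [koszul_eq, koszul_eq, map_sum, ← Finset.sum_neg_distrib]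
  refine Finset.sum_congr rfl fun w _ => ?_
  rw [map_smul]
  by_cases h : v = w
  · subst h; simp [contract_contract_self]
  · rw [contract_comm h, smul_neg]

theorem koszul_koszul (x : V → R) (c : Finset V → M) : koszul x (koszul x c) = 0 := by
  -- Induction over partial sums: the square of each new term vanishes, and its cross terms cancel
  -- because contractions anticommute.
  have key : ∀ s : Finset V, ∀ c : Finset V → M, (∑ v ∈ s, x v • contract R v)
      ((∑ v ∈ s, x v • contract R v) c) = 0 := by
    intro s
    induction s using Finset.induction_on with
    | empty => simp
    | insert a s ha ih =>
      intro c
      have e : (∑ v ∈ s, x v • contract R v) (contract R a c) =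
          - contract R a ((∑ v ∈ s, x v • contract R v) c) := by
        simp only [LinearMap.sum_apply, map_sum, LinearMap.smul_apply, map_smul,
          ← Finset.sum_neg_distrib]
        refine Finset.sum_congr rfl fun w hw => ?_
        rw [contract_comm (fun h : w = a => ha (h ▸ hw)), smul_neg]
      rw [Finset.sum_insert ha]
      simp only [LinearMap.add_apply, LinearMap.smul_apply, map_add, map_smul, ih, e,
        contract_contract_self]
      simp
  exact key _ _

/-- Exterior multiplication by `v` is a homotopy from multiplication by `x v` to zero. With all `x v
= 1` this makes cones acyclic. -/
theorem koszul_wedge (x : V → R) (v : V) (c : Finset V → M) :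
    koszul x (wedge R v c) = x v • c - wedge R v (koszul x c) := by
  rw [eq_sub_iff_add_eq, koszul_eq, koszul_eq, map_sum, ← Finset.sum_add_distrib,
    Finset.sum_eq_single v]
  · rw [map_smul, ← smul_add, contract_wedge_self]
  · intro w _ hw
    rw [contract_wedge hw, map_smul]; simp
  · simp

theorem koszul_map {M' : Type*} [AddCommGroup M'] [Module R M'] (x : V → R) (φ : M →ₗ[R] M')
    (c : Finset V → M) : koszul x (fun τ => φ (c τ)) = fun τ => φ (koszul x c τ) := by
  ext τ
  simp only [koszul_apply, map_sum, map_smul, contract_apply]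
  refine Finset.sum_congr rfl fun v _ => ?_
  split_ifs <;> simp

end KoszulOperators

/-! ### Upper Koszul complexes and Mayer–Vietoris -/

section DegreeComplexes

set_option linter.unusedSectionVars false

variable {V : Type*} [LinearOrder V] [Fintype V]

/-- The exponent of the squarefree monomial with support `τ`. -/
def faceExponent (τ : Finset V) : V →₀ ℕ :=
  Finsupp.equivFunOnFinite.symm fun v => if v ∈ τ then 1 else 0

theorem faceExponent_apply (τ : Finset V) (v : V) :
    faceExponent τ v = if v ∈ τ then 1 else 0 := rfl

theorem degree_eq_sum_univ (α : V →₀ ℕ) : α.degree = ∑ v, α v := by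
  rw [Finsupp.degree_eq_sum]

theorem degree_faceExponent (τ : Finset V) : (faceExponent τ).degree = τ.card := by
  simp [degree_eq_sum_univ, faceExponent_apply]

theorem faceExponent_insert {v : V} {τ : Finset V} (h : v ∉ τ) :
    faceExponent (insert v τ) = faceExponent τ + Finsupp.single v 1 := by
  ext w
  simp only [faceExponent_apply, Finset.mem_insert, Finsupp.add_apply, Finsupp.single_apply]
  by_cases hw : w = v
  · subst hw; simp [h]
  · simp [hw, Ne.symm hw]

theorem faceExponent_empty : faceExponent (∅ : Finset V) = 0 := by
  ext w; simp [faceExponent_apply]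

/-- The upper Koszul complex in degree `α` of the monomial ideal with set of exponents `S`. -/
def degreeComplex (S : Set (V →₀ ℕ)) (α : V →₀ ℕ) : Set (Finset V) :=
  {τ | faceExponent τ ≤ α ∧ α - faceExponent τ ∈ S}

theorem faceExponent_mono {σ τ : Finset V} (h : σ ⊆ τ) : faceExponent σ ≤ faceExponent τ := by
  intro v
  simp only [faceExponent_apply]
  by_cases hv : v ∈ σ
  · simp [hv, h hv]
  · simp [hv]

theorem isLowerSet_degreeComplex {S : Set (V →₀ ℕ)} (hS : IsUpperSet S) (α : V →₀ ℕ) :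
    IsLowerSet (degreeComplex S α) := fun _ _ h hτ =>
  ⟨(faceExponent_mono h).trans hτ.1, hS (tsub_le_tsub_left (faceExponent_mono h) _) hτ.2⟩

theorem degreeComplex_union (S T : Set (V →₀ ℕ)) (α : V →₀ ℕ) :
    degreeComplex (S ∪ T) α = degreeComplex S α ∪ degreeComplex T α := by
  ext τ; simp only [degreeComplex, Set.mem_union, Set.mem_ofPred_eq]; tauto

theorem degreeComplex_inter (S T : Set (V →₀ ℕ)) (α : V →₀ ℕ) :
    degreeComplex (S ∩ T) α = degreeComplex S α ∩ degreeComplex T α := by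
  ext τ; simp only [degreeComplex, Set.mem_inter_iff, Set.mem_ofPred_eq]; tauto

variable {K : Type*} [Field K]

/-- Chains of a family of faces, supported on faces with `i` vertices. -/
def IsChainOf (Δ : Set (Finset V)) (i : ℕ) (f : Finset V → K) : Prop :=
  ∀ τ, f τ ≠ 0 → τ ∈ Δ ∧ τ.card = i

theorem IsChainOf.mono {Δ Γ : Set (Finset V)} {i : ℕ} {f : Finset V → K} (h : IsChainOf Δ i f)
    (hΔ : Δ ⊆ Γ) : IsChainOf Γ i f := fun τ hτ => ⟨hΔ (h τ hτ).1, (h τ hτ).2⟩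

theorem IsChainOf.add {Δ : Set (Finset V)} {i : ℕ} {f g : Finset V → K} (hf : IsChainOf Δ i f)
    (hg : IsChainOf Δ i g) : IsChainOf Δ i (f + g) := fun τ hτ => by
  by_cases h : f τ = 0
  · exact hg τ fun h' => hτ (by simp [h, h'])
  · exact hf τ h

theorem IsChainOf.neg {Δ : Set (Finset V)} {i : ℕ} {f : Finset V → K} (hf : IsChainOf Δ i f) :
    IsChainOf Δ i (-f) := fun τ hτ => hf τ (by simpa using hτ)

theorem IsChainOf.sub {Δ : Set (Finset V)} {i : ℕ} {f g : Finset V → K} (hf : IsChainOf Δ i f)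
    (hg : IsChainOf Δ i g) : IsChainOf Δ i (f - g) := by
  rw [sub_eq_add_neg]; exact hf.add hg.neg

theorem IsChainOf.inter {Δ Γ : Set (Finset V)} {i : ℕ} {f : Finset V → K} (h : IsChainOf Δ i f)
    (h' : IsChainOf Γ i f) : IsChainOf (Δ ∩ Γ) i f :=
  fun τ hτ => ⟨⟨(h τ hτ).1, (h' τ hτ).1⟩, (h τ hτ).2⟩

theorem IsChainOf.exists_add {Δ Γ : Set (Finset V)} {i : ℕ} {f : Finset V → K}
    (h : IsChainOf (Δ ∪ Γ) i f) :
    ∃ g g', IsChainOf Δ i g ∧ IsChainOf Γ i g' ∧ g + g' = f := by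
  classical
  refine ⟨fun τ => if τ ∈ Δ then f τ else 0, fun τ => if τ ∈ Δ then 0 else f τ, ?_, ?_, ?_⟩
  · intro τ hτ
    by_cases hΔ : τ ∈ Δ
    · simp only [hΔ, if_true] at hτ; exact ⟨hΔ, (h τ hτ).2⟩
    · simp [hΔ] at hτ
  · intro τ hτ
    by_cases hΔ : τ ∈ Δ
    · simp [hΔ] at hτ
    · simp only [hΔ, if_false] at hτ; exact ⟨(h τ hτ).1.resolve_left hΔ, (h τ hτ).2⟩
  · ext τ; by_cases hΔ : τ ∈ Δ <;> simp [hΔ]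

variable (K) in
/-- The simplicial boundary. -/
abbrev boundary : (Finset V → K) →ₗ[K] (Finset V → K) := koszul (1 : V → K)

theorem IsChainOf.contract {Δ Γ : Set (Finset V)} {i : ℕ} {f : Finset V → K} {v : V}
    (h : IsChainOf Δ (i + 1) f) (hΔ : ∀ τ, v ∉ τ → insert v τ ∈ Δ → τ ∈ Γ) :
    IsChainOf Γ i (contract K v f) := fun τ hτ => by
  rw [contract_apply] at hτ
  by_cases hv : v ∈ τ
  · simp [hv] at hτ
  rw [if_neg hv] at hτ
  have := h _ (fun h0 => hτ (by rw [h0, smul_zero]))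
  rw [Finset.card_insert_of_notMem hv] at this
  exact ⟨hΔ τ hv this.1, by omega⟩

theorem IsChainOf.wedge {Δ Γ : Set (Finset V)} {i : ℕ} {f : Finset V → K} {v : V}
    (h : IsChainOf Δ i f) (hΔ : ∀ τ, v ∉ τ → τ ∈ Δ → insert v τ ∈ Γ) :
    IsChainOf Γ (i + 1) (wedge K v f) := fun τ hτ => by
  rw [wedge_apply] at hτ
  by_cases hv : v ∈ τ
  · rw [if_pos hv] at hτ
    have := h _ (fun h0 => hτ (by rw [h0, smul_zero]))
    rw [← Finset.insert_erase hv]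
    refine ⟨hΔ _ (by simp) this.1, ?_⟩
    rw [Finset.card_insert_of_notMem (by simp), this.2]
  · simp [hv] at hτ

/-- Contraction after coning serves as the restriction of a chain to the faces that avoid `v`. -/
theorem contract_wedge_apply (v : V) (f : Finset V → K) (τ : Finset V) :
    contract K v (wedge K v f) τ = if v ∈ τ then 0 else f τ := by
  by_cases hv : v ∈ τ
  · simp [contract_apply, hv]
  · simp only [contract_apply, wedge_apply, hv, if_false, Finset.mem_insert_self, if_true,
      Finset.erase_insert hv, ← mul_smul, faceSign_insert_self, faceSign_mul_self, one_smul]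

theorem IsChainOf.contract_wedge {Δ Γ : Set (Finset V)} {i : ℕ} {f : Finset V → K} {v : V}
    (h : IsChainOf Δ i f) (hΔ : ∀ τ, v ∉ τ → τ ∈ Δ → τ ∈ Γ) :
    IsChainOf Γ i (EdgeIdealPowers.contract K v (EdgeIdealPowers.wedge K v f)) := fun τ hτ => by
  rw [contract_wedge_apply] at hτ
  by_cases hv : v ∈ τ
  · simp [hv] at hτ
  · rw [if_neg hv] at hτ
    exact ⟨hΔ τ hv (h τ hτ).1, (h τ hτ).2⟩

theorem contract_eq_zero {f : Finset V → K} {v : V} (h : ∀ τ, v ∈ τ → f τ = 0) :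
    contract K v f = 0 := by
  ext τ; simp [contract_apply, h (insert v τ)]

theorem IsChainOf.boundary {Δ : Set (Finset V)} (hΔ : IsLowerSet Δ) {i : ℕ} {f : Finset V → K}
    (h : IsChainOf Δ (i + 1) f) : IsChainOf Δ i (boundary K f) := by
  intro τ hτ
  rw [koszul_apply] at hτ
  obtain ⟨v, -, hv⟩ := Finset.exists_ne_zero_of_sum_ne_zero hτ
  exact (h.contract (v := v) (Γ := Δ) fun σ _ hσ => hΔ (Finset.subset_insert v σ) hσ) τ
    (by simpa using hv)

theorem IsChainOf.boundary_zero {Δ : Set (Finset V)} {f : Finset V → K}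
    (h : IsChainOf Δ 0 f) : EdgeIdealPowers.boundary K f = 0 := by
  ext τ
  rw [koszul_apply]
  refine Finset.sum_eq_zero fun v _ => ?_
  have : f (insert v τ) = 0 := by
    by_contra h'
    simpa using (h _ h').2
  simp [contract_apply, this]

theorem boundary_boundary (f : Finset V → K) : boundary K (boundary K f) = 0 := koszul_koszul _ _

theorem boundary_wedge (v : V) (f : Finset V → K) :
    boundary K (wedge K v f) = f - wedge K v (boundary K f) := by
  rw [boundary, koszul_wedge]; simp

theorem contract_boundary (v : V) (f : Finset V → K) :
    contract K v (boundary K f) = - boundary K (contract K v f) := contract_koszul _ _ _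

variable (K) in
/-- The vanishing of the reduced homology of a family of faces at faces with `i` vertices. -/
def IsAcyclicAt (Δ : Set (Finset V)) (i : ℕ) : Prop :=
  ∀ f : Finset V → K, IsChainOf Δ i f → boundary K f = 0 →
    ∃ g, IsChainOf Δ (i + 1) g ∧ boundary K g = f

theorem isAcyclicAt_of_cone {Δ : Set (Finset V)} (v : V) (h : ∀ τ ∈ Δ, insert v τ ∈ Δ) (i : ℕ) :
    IsAcyclicAt K Δ i := fun f hf h0 =>
  ⟨wedge K v f, hf.wedge fun τ _ hτ => h τ hτ, by rw [boundary_wedge, h0]; simp⟩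

theorem isAcyclicAt_of_forall_notMem {Δ : Set (Finset V)} {i : ℕ}
    (h : ∀ τ : Finset V, τ.card = i → τ ∉ Δ) : IsAcyclicAt K Δ i := fun f hf _ =>
  ⟨0, fun τ hτ => absurd rfl hτ, by
    ext τ; by_contra h'
    have := hf τ (by simpa [eq_comm] using h')
    exact h τ this.2 this.1⟩

/-- Exactness of Mayer–Vietoris at the direct sum. A filling in the union is split, and the boundary
of its `Γ` part lies in both complexes, so that part can be replaced by a chain of the intersection.
-/
theorem IsAcyclicAt.of_union_inter {Δ Γ : Set (Finset V)} (hΔ : IsLowerSet Δ) (hΓ : IsLowerSet Γ)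
    {i : ℕ} (hu : IsAcyclicAt K (Δ ∪ Γ) i) (hi : IsAcyclicAt K (Δ ∩ Γ) i) :
    IsAcyclicAt K Δ i := by
  intro f hf h0
  obtain ⟨g, hg, rfl⟩ := hu f (hf.mono Set.subset_union_left) h0
  obtain ⟨g₁, g₂, h₁, h₂, rfl⟩ := hg.exists_add
  have e : boundary K g₂ = boundary K (g₁ + g₂) - boundary K g₁ := by simp
  obtain ⟨h, hh, hh'⟩ := hi (boundary K g₂)
    (IsChainOf.inter (e ▸ hf.sub (h₁.boundary hΔ)) (h₂.boundary hΓ)) (boundary_boundary _)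
  exact ⟨g₁ + h, h₁.add (hh.mono Set.inter_subset_left), by rw [map_add, hh', map_add]⟩

/-- Two fillings, one in each complex, differ by a cycle of the union with one more vertex per face;
this is the connecting map, and it explains the shift to `i + 1`. -/
theorem IsAcyclicAt.inter {Δ Γ : Set (Finset V)} (hΔ : IsLowerSet Δ) (hΓ : IsLowerSet Γ)
    {i : ℕ} (h₁ : IsAcyclicAt K Δ i) (h₂ : IsAcyclicAt K Γ i)
    (hu : IsAcyclicAt K (Δ ∪ Γ) (i + 1)) : IsAcyclicAt K (Δ ∩ Γ) i := by
  intro f hf h0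
  obtain ⟨g, hg, hg'⟩ := h₁ f (hf.mono Set.inter_subset_left) h0
  obtain ⟨g', hg1, hg1'⟩ := h₂ f (hf.mono Set.inter_subset_right) h0
  obtain ⟨k, hk, hk'⟩ := hu (g - g')
    ((hg.mono Set.subset_union_left).sub (hg1.mono Set.subset_union_right))
    (by rw [map_sub, hg', hg1', sub_self])
  obtain ⟨k₁, k₂, hk₁, hk₂, rfl⟩ := hk.exists_add
  have e : g - boundary K k₁ = g' + boundary K k₂ := by
    rw [map_add] at hk'
    rw [sub_eq_iff_eq_add, add_assoc, add_comm (boundary K k₂), hk']; abel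
  refine ⟨g - boundary K k₁, IsChainOf.inter (hg.sub (hk₁.boundary hΔ)) ?_, ?_⟩
  · rw [e]; exact hg1.add (hk₂.boundary hΓ)
  · rw [map_sub, boundary_boundary, hg', sub_zero]

theorem IsAcyclicAt.union {Δ Γ : Set (Finset V)} (hΔ : IsLowerSet Δ) (hΓ : IsLowerSet Γ)
    {i : ℕ} (h₁ : IsAcyclicAt K Δ (i + 1)) (h₂ : IsAcyclicAt K Γ (i + 1))
    (hi : IsAcyclicAt K (Δ ∩ Γ) i) : IsAcyclicAt K (Δ ∪ Γ) (i + 1) := by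
  intro f hf h0
  obtain ⟨f₁, f₂, hf₁, hf₂, rfl⟩ := hf.exists_add
  have e : boundary K f₁ = - boundary K f₂ := by
    rw [map_add] at h0; exact eq_neg_of_add_eq_zero_left h0
  obtain ⟨k, hk, hk'⟩ := hi (boundary K f₁)
    (IsChainOf.inter (hf₁.boundary hΔ) (e ▸ (hf₂.boundary hΓ).neg)) (boundary_boundary _)
  obtain ⟨g₁, hg₁, hg₁'⟩ := h₁ (f₁ - k) (hf₁.sub (hk.mono Set.inter_subset_left))
    (by rw [map_sub, hk', sub_self])
  obtain ⟨g₂, hg₂, hg₂'⟩ := h₂ (f₂ + k) (hf₂.add (hk.mono Set.inter_subset_right))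
    (by rw [map_add, hk', e, add_neg_cancel])
  refine ⟨g₁ + g₂, (hg₁.mono Set.subset_union_left).add (hg₂.mono Set.subset_union_right), ?_⟩
  rw [map_add, hg₁', hg₂']; abel

/-- The index not covered by `IsAcyclicAt.union`: chains on the empty face are always cycles, so
both summands can be filled separately and no condition on the intersection arises. -/
theorem IsAcyclicAt.union_zero {Δ Γ : Set (Finset V)} (h₁ : IsAcyclicAt K Δ 0)
    (h₂ : IsAcyclicAt K Γ 0) : IsAcyclicAt K (Δ ∪ Γ) 0 := by
  intro f hf h0
  obtain ⟨f₁, f₂, hf₁, hf₂, rfl⟩ := hf.exists_add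
  obtain ⟨g₁, hg₁, hg₁'⟩ := h₁ f₁ hf₁ hf₁.boundary_zero
  obtain ⟨g₂, hg₂, hg₂'⟩ := h₂ f₂ hf₂ hf₂.boundary_zero
  exact ⟨g₁ + g₂, (hg₁.mono Set.subset_union_left).add (hg₂.mono Set.subset_union_right), by
    rw [map_add, hg₁', hg₂']⟩

end DegreeComplexes

/-! ### Regularity bounds for monomial ideals: colons, sums with variables, disjoint edges -/

section MonomialRegularity

set_option linter.unusedSectionVars false

variable {V : Type*} [LinearOrder V] [Fintype V] {K : Type*} [Field K]

variable (K) in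
/-- The Castelnuovo–Mumford regularity of the monomial ideal with set of exponents `S` is at
most `r`, in terms of the upper Koszul complexes. -/
def MonomialRegLE (S : Set (V →₀ ℕ)) (r : ℤ) : Prop :=
  ∀ (α : V →₀ ℕ) (i : ℕ), i + r < (α.degree : ℤ) → IsAcyclicAt K (degreeComplex S α) i

theorem MonomialRegLE.inter {A B : Set (V →₀ ℕ)} (hA : IsUpperSet A) (hB : IsUpperSet B) {r : ℤ}
    (h₁ : MonomialRegLE K A r) (h₂ : MonomialRegLE K B r) (hu : MonomialRegLE K (A ∪ B) (r - 1)) :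
    MonomialRegLE K (A ∩ B) r := fun α i hi => by
  rw [degreeComplex_inter]
  refine (h₁ α i hi).inter (isLowerSet_degreeComplex hA α) (isLowerSet_degreeComplex hB α)
    (h₂ α i hi) ?_
  rw [← degreeComplex_union]
  exact hu α (i + 1) (by push_cast; omega)

theorem degree_tsub_of_le {α β : V →₀ ℕ} (h : β ≤ α) :
    ((α - β).degree : ℤ) = α.degree - β.degree := by
  conv_rhs => rw [← tsub_add_cancel_of_le h, map_add]
  push_cast; ring

/-- The exponents of the colon ideal by the monomial with exponent `m`. -/
def monomialColon (S : Set (V →₀ ℕ)) (m : V →₀ ℕ) : Set (V →₀ ℕ) := {β | β + m ∈ S}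

theorem mem_monomialColon {S : Set (V →₀ ℕ)} {m β : V →₀ ℕ} :
    β ∈ monomialColon S m ↔ β + m ∈ S := Iff.rfl

theorem isUpperSet_monomialColon {S : Set (V →₀ ℕ)} (hS : IsUpperSet S) (m : V →₀ ℕ) :
    IsUpperSet (monomialColon S m) := fun _ _ h hx => hS (by gcongr) hx

/-- The intersection of an ideal with the principal ideal of m is m times the colon ideal, so its
complexes are those of the colon shifted by `m`. -/
theorem degreeComplex_inter_Ici {S : Set (V →₀ ℕ)} {m α : V →₀ ℕ} (h : m ≤ α) :
    degreeComplex (S ∩ Set.Ici m) α = degreeComplex (monomialColon S m) (α - m) := by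
  ext τ
  have e1 : ∀ v, m v ≤ α v := h
  constructor
  · rintro ⟨h1, h2, h3⟩
    have h3' : ∀ v, m v ≤ (α - faceExponent τ) v := h3
    have h1' : ∀ v, faceExponent τ v ≤ α v := h1
    refine ⟨fun v => ?_, ?_⟩
    · have := h3' v; have := h1' v
      simp only [Finsupp.tsub_apply] at *; omega
    · rw [mem_monomialColon]
      convert h2 using 1
      ext v
      have := h3' v; have := h1' v
      simp only [Finsupp.tsub_apply, Finsupp.add_apply] at *; omega
  · rintro ⟨h1, h2⟩
    have h1' : ∀ v, faceExponent τ v ≤ (α - m) v := h1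
    rw [mem_monomialColon] at h2
    have e : α - m - faceExponent τ + m = α - faceExponent τ := by
      ext v
      have := h1' v; have := e1 v
      simp only [Finsupp.tsub_apply, Finsupp.add_apply] at *; omega
    rw [e] at h2
    refine ⟨fun v => ?_, h2, fun v => ?_⟩
    · have := h1' v; have := e1 v
      simp only [Finsupp.tsub_apply] at *; omega
    · have := h1' v; have := e1 v
      simp only [Finsupp.tsub_apply] at *; omega

theorem degreeComplex_inter_Ici_of_not_le {S : Set (V →₀ ℕ)} {m α : V →₀ ℕ} (h : ¬ m ≤ α) :
    degreeComplex (S ∩ Set.Ici m) α = ∅ := by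
  ext τ
  simp only [Set.mem_empty_iff_false, iff_false]
  rintro ⟨-, -, h3⟩
  exact h ((Set.mem_Ici.1 h3).trans tsub_le_self)

theorem isAcyclicAt_inter_Ici {S : Set (V →₀ ℕ)} {m α : V →₀ ℕ} {r : ℤ} {i : ℕ}
    (h : MonomialRegLE K (monomialColon S m) r) (hi : i + r + m.degree < (α.degree : ℤ)) :
    IsAcyclicAt K (degreeComplex (S ∩ Set.Ici m) α) i := by
  by_cases hm : m ≤ α
  · rw [degreeComplex_inter_Ici hm]
    exact h _ _ (by rw [degree_tsub_of_le hm]; omega)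
  · rw [degreeComplex_inter_Ici_of_not_le hm]
    exact isAcyclicAt_of_forall_notMem (by simp)

/-- Mayer–Vietoris for the ideal and the principal ideal of m, whose intersection is the colon
shifted by the degree of m. -/
theorem MonomialRegLE.of_colon {S : Set (V →₀ ℕ)} (hS : IsUpperSet S) {r : ℤ} (m : V →₀ ℕ)
    (h₁ : MonomialRegLE K (monomialColon S m) (r - m.degree))
    (h₂ : MonomialRegLE K (S ∪ Set.Ici m) r) : MonomialRegLE K S r := fun α i hi => by
  refine IsAcyclicAt.of_union_inter (isLowerSet_degreeComplex hS α)
    (isLowerSet_degreeComplex (isUpperSet_Ici m) α) ?_ ?_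
  · rw [← degreeComplex_union]; exact h₂ α i hi
  · rw [← degreeComplex_inter]
    exact isAcyclicAt_inter_Ici h₁ (by omega)

/-- In every degree properly above `m` the complex is a cone, with apex any vertex where the
exponent exceeds that of `m`. -/
theorem monomialRegLE_Ici (m : V →₀ ℕ) {r : ℤ} (hr : m.degree ≤ r) :
    MonomialRegLE K (Set.Ici m) r := fun α i hi => by
  by_cases hm : m ≤ α
  · obtain ⟨v, hv⟩ : ∃ v, m v < α v := by
      by_contra! h
      have : α = m := le_antisymm h hm
      subst this; omega
    refine isAcyclicAt_of_cone v (fun τ hτ => ?_) i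
    by_cases hvτ : v ∈ τ
    · rwa [Finset.insert_eq_of_mem hvτ]
    obtain ⟨h1, h2⟩ := hτ
    have h1' : ∀ w, faceExponent τ w ≤ α w := h1
    have h2' : ∀ w, m w ≤ (α - faceExponent τ) w := h2
    have hv0 : faceExponent τ v = 0 := by simp [faceExponent_apply, hvτ]
    rw [degreeComplex, Set.mem_ofPred_eq, faceExponent_insert hvτ]
    refine ⟨fun w => ?_, fun w => ?_⟩ <;>
    · have := h1' w; have := h2' w
      simp only [Finsupp.tsub_apply, Finsupp.add_apply, Finsupp.single_apply] at *
      split_ifs with hvw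
      · subst hvw; omega
      · omega
  · rw [← Set.univ_inter (Set.Ici m), degreeComplex_inter_Ici_of_not_le hm]
    exact isAcyclicAt_of_forall_notMem (by simp)

theorem boundary_contract_wedge {x : V} {g : Finset V → K} (h : contract K x (boundary K g) = 0) :
    boundary K (contract K x (wedge K x g)) = boundary K g - contract K x g := by
  have e := contract_wedge_self (R := K) x (boundary K g)
  rw [h, map_zero, add_zero] at e
  rw [← neg_eq_iff_eq_neg.2 (contract_boundary (K := K) x (wedge K x g)), boundary_wedge, map_sub,
    neg_sub, e]

/-- The complex of the colon in degree α is compared with that of S in degree α + x. They agree if x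
divides α; otherwise the former is the deletion of x from the latter, and the link of x is the
complex of S in degree α. -/
theorem MonomialRegLE.colon_single {S : Set (V →₀ ℕ)} (hS : IsUpperSet S) {r : ℤ}
    (h : MonomialRegLE K S r) (x : V) :
    MonomialRegLE K (monomialColon S (Finsupp.single x 1)) r := fun α i hi => by
  have hdeg : ((α + Finsupp.single x 1).degree : ℤ) = α.degree + 1 := by simp
  have key : ∀ τ, faceExponent τ ≤ α → (τ ∈ degreeComplex (monomialColon S (Finsupp.single x 1)) α ↔
      τ ∈ degreeComplex S (α + Finsupp.single x 1)) := by
    intro τ hτ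
    have e : α - faceExponent τ + Finsupp.single x 1 = α + Finsupp.single x 1 - faceExponent τ :=
      (tsub_add_eq_add_tsub hτ)
    simp only [degreeComplex, Set.mem_ofPred_eq, mem_monomialColon, e, hτ, true_and,
      hτ.trans (le_self_add : α ≤ α + Finsupp.single x 1)]
  by_cases hx : α x = 0
  · have hnot : ∀ τ, x ∈ τ → ¬ faceExponent τ ≤ α := fun τ hxτ h' => by
      have := h' x
      simp [faceExponent_apply, hxτ, hx] at this
    have hle : ∀ τ, x ∉ τ → faceExponent τ ≤ α + Finsupp.single x 1 → faceExponent τ ≤ α := by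
      intro τ hxτ h' v
      have := h' v
      simp only [Finsupp.add_apply, Finsupp.single_apply] at this
      by_cases hv : x = v
      · subst hv; simp [faceExponent_apply, hxτ]
      · simpa [hv] using this
    intro f hf h0
    obtain ⟨g, hg, rfl⟩ := h (α + Finsupp.single x 1) i (by omega) f
      (fun τ hτ => ⟨(key τ (hf τ hτ).1.1).1 (hf τ hτ).1, (hf τ hτ).2⟩) h0
    have hc : contract K x (boundary K g) = 0 := contract_eq_zero fun τ hτ => by
      by_contra h'
      exact hnot τ hτ (hf τ h').1.1
    rw [contract_boundary, neg_eq_zero] at hc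
    have hg2 : IsChainOf (degreeComplex S α) i (contract K x g) := by
      refine hg.contract fun τ hxτ hτ => ?_
      have h1 := hτ.1
      have h2 := hτ.2
      rw [faceExponent_insert hxτ] at h1 h2
      refine ⟨by simpa using h1, ?_⟩
      rwa [add_tsub_add_eq_tsub_right] at h2
    -- Discarding the faces of `g` through `x` changes its boundary by the contraction of `g`, a
    -- cycle in the link; `k` fills that cycle and repairs the boundary.
    obtain ⟨k, hk, hk'⟩ := h α i (by omega) _ hg2 hc
    refine ⟨contract K x (wedge K x g) + k, IsChainOf.add (hg.contract_wedge fun τ hxτ hτ => ?_)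
      (hk.mono fun τ hτ => ⟨hτ.1, hS le_self_add hτ.2⟩), ?_⟩
    · exact (key τ (hle τ hxτ hτ.1)).2 hτ
    · rw [map_add, hk', boundary_contract_wedge (by rw [contract_boundary, hc, neg_zero])]; abel
  · have e : degreeComplex (monomialColon S (Finsupp.single x 1)) α =
        degreeComplex S (α + Finsupp.single x 1) := by
      ext τ
      by_cases hτ : faceExponent τ ≤ α
      · exact key τ hτ
      refine iff_of_false (fun h' => hτ h'.1) fun h' => hτ fun v => ?_
      have := h'.1 v
      simp only [Finsupp.add_apply, Finsupp.single_apply, faceExponent_apply] at this ⊢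
      by_cases hv : x = v
      · subst hv; split_ifs <;> omega
      · simpa [hv] using this
    rw [e]
    exact h _ _ (by omega)

/-- Mayer–Vietoris again. The intersection is the colon by x shifted by one degree, and the
connecting map lowers the homological index by one, so the two shifts cancel. The bound `1 ≤ r`
accounts for the ideal (x) itself. -/
theorem MonomialRegLE.union_single {S : Set (V →₀ ℕ)} (hS : IsUpperSet S) {r : ℤ} (hr : 1 ≤ r)
    (h : MonomialRegLE K S r) (x : V) :
    MonomialRegLE K (S ∪ Set.Ici (Finsupp.single x 1)) r := fun α i hi => by
  have h2 : MonomialRegLE K (Set.Ici (Finsupp.single x 1)) r :=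
    monomialRegLE_Ici _ (by simpa using hr)
  rw [degreeComplex_union]
  cases i with
  | zero => exact (h α 0 hi).union_zero (h2 α 0 hi)
  | succ i =>
    refine (h α _ hi).union (isLowerSet_degreeComplex hS α)
      (isLowerSet_degreeComplex (isUpperSet_Ici _) α) (h2 α _ hi) ?_
    rw [← degreeComplex_inter]
    refine isAcyclicAt_inter_Ici (h.colon_single hS x) ?_
    simp only [Finsupp.degree_single]; push_cast at hi ⊢; omega

/-- The exponents of the monomials that lie in the ideal generated by the variables in `W`. -/
def variableSet (W : Set V) : Set (V →₀ ℕ) := {β | ∃ w ∈ W, β w ≠ 0}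

theorem isUpperSet_variableSet (W : Set V) : IsUpperSet (variableSet W) := by
  rintro a b hab ⟨w, hw, h⟩
  have : a w ≤ b w := hab w
  exact ⟨w, hw, by omega⟩

theorem MonomialRegLE.union_variableSet {S : Set (V →₀ ℕ)} (hS : IsUpperSet S) {r : ℤ} (hr : 1 ≤ r)
    (h : MonomialRegLE K S r) (W : Set V) : MonomialRegLE K (S ∪ variableSet W) r := by
  classical
  have key : ∀ s : Finset V, MonomialRegLE K (S ∪ variableSet (s : Set V)) r := by
    intro s
    induction s using Finset.induction_on with
    | empty => simpa [variableSet] using h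
    | insert a s ha ih =>
      have e : S ∪ variableSet ((insert a s : Finset V) : Set V) =
          (S ∪ variableSet (s : Set V)) ∪ Set.Ici (Finsupp.single a 1) := by
        ext β
        simp [variableSet, Nat.one_le_iff_ne_zero, Finsupp.single_le_iff]
        rw [or_assoc, or_comm (a := ¬ β a = 0)]
      rw [e]
      exact ih.union_single (hS.union (isUpperSet_variableSet _)) hr a
  have := key (Set.toFinite W).toFinset
  simpa using this

/-- Here U does not involve a or b. The relation between U and the regular element ab moves a Betti
number of U one homological step and two degrees up in T = U + (ab), which costs one in regularity.
On complexes this is a suspension. -/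
theorem MonomialRegLE.of_union_edge {T U : Set (V →₀ ℕ)} (hU : IsUpperSet U) (hU0 : 0 ∉ U) {a b : V}
    (hab : a ≠ b) (hT : ∀ β, β ∈ T ↔ β ∈ U ∨ (β a ≠ 0 ∧ β b ≠ 0))
    (hUa : ∀ β, β + Finsupp.single a 1 ∈ U → β ∈ U) (hUb : ∀ β, β + Finsupp.single b 1 ∈ U → β ∈ U)
    {r : ℤ} (h : MonomialRegLE K T r) : MonomialRegLE K U (r - 1) := fun α i hi => by
  have cone : ∀ x, (∀ β, β + Finsupp.single x 1 ∈ U → β ∈ U) → α x ≠ 0 →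
      IsAcyclicAt K (degreeComplex U α) i := by
    intro x hx hαx
    refine isAcyclicAt_of_cone x (fun τ hτ => ?_) i
    by_cases hxτ : x ∈ τ
    · rwa [Finset.insert_eq_of_mem hxτ]
    have hle : faceExponent τ + Finsupp.single x 1 ≤ α := fun v => by
      have := hτ.1 v
      simp only [Finsupp.add_apply, Finsupp.single_apply]
      by_cases hv : x = v
      · subst hv; simp [faceExponent_apply, hxτ]; omega
      · simpa [hv] using this
    rw [degreeComplex, Set.mem_ofPred_eq, faceExponent_insert hxτ]
    refine ⟨hle, hx _ ?_⟩
    convert hτ.2 using 1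
    ext v
    have := hle v
    simp only [Finsupp.add_apply, Finsupp.tsub_apply] at this ⊢; omega
  by_cases ha : α a = 0
  swap
  · exact cone a hUa ha
  by_cases hb : α b = 0
  swap
  · exact cone b hUb hb
  by_cases h0 : α = 0
  · subst h0
    refine isAcyclicAt_of_forall_notMem fun τ _ hτ => hU0 ?_
    simpa using hτ.2
  obtain ⟨w, hw⟩ : ∃ w, α w ≠ 0 := by
    by_contra! h'; exact h0 (Finsupp.ext h')
  have hwa : w ≠ a := fun h' => hw (h' ▸ ha)
  have hwb : w ≠ b := fun h' => hw (h' ▸ hb)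
  have fa : ∀ τ, faceExponent τ ≤ α → a ∉ τ := fun τ h1 h2 => by
    have := h1 a; simp [faceExponent_apply, h2, ha] at this
  have fb : ∀ τ, faceExponent τ ≤ α → b ∉ τ := fun τ h1 h2 => by
    have := h1 b; simp [faceExponent_apply, h2, hb] at this
  set α' := α + Finsupp.single a 1 + Finsupp.single b 1 with hα'
  intro f hf hf0
  have hfa : contract K a f = 0 := contract_eq_zero fun τ hτ => by
    by_contra h'; exact fa τ (hf τ h').1.1 hτ
  have hfb : contract K b f = 0 := contract_eq_zero fun τ hτ => by
    by_contra h'; exact fb τ (hf τ h').1.1 hτ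
  have hw_f : IsChainOf {τ | faceExponent τ ≤ α} (i + 1) (wedge K w f) := by
    refine hf.wedge fun τ hwτ hτ => ?_
    rw [Set.mem_ofPred_eq, faceExponent_insert hwτ]
    intro v
    have := hτ.1 v
    simp only [Finsupp.add_apply, Finsupp.single_apply]
    by_cases hv : w = v
    · subst hv; simp [faceExponent_apply, hwτ]; omega
    · simpa [hv] using this
  have hαα' : α ≤ α' := by rw [hα', add_assoc]; exact le_self_add
  -- The suspension of `f`: the cone from `a` lies in the complex because `f` lives in U, the cone
  -- from `w` because its faces avoid `a` and `b` and leave the factor ab intact.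
  have hz : IsChainOf (degreeComplex T α') (i + 1) (wedge K a f - wedge K w f) := by
    refine IsChainOf.sub (hf.wedge fun τ haτ hτ => ?_) (hw_f.mono fun τ hτ => ⟨hτ.trans hαα', ?_⟩)
    · rw [degreeComplex, Set.mem_ofPred_eq, faceExponent_insert haτ, hα', add_right_comm]
      refine ⟨(add_le_add_left hτ.1 _).trans le_self_add |>.trans_eq (add_right_comm _ _ _), (hT _).2 (Or.inl (hU ?_ hτ.2))⟩
      intro v
      simp only [Finsupp.add_apply, Finsupp.tsub_apply]; omega
    · refine (hT _).2 (Or.inr ⟨?_, ?_⟩)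
      · simp [hα', faceExponent_apply, fa τ hτ, hab.symm]
      · simp [hα', faceExponent_apply, fb τ hτ, hab]
  obtain ⟨g, hg, hgz⟩ := h α' (i + 1) (by rw [hα']; simp; omega) _ hz
    (by rw [map_sub, boundary_wedge, boundary_wedge, hf0]; simp)
  have e1 : boundary K (contract K a g) = - f := by
    rw [← neg_eq_iff_eq_neg, ← contract_boundary, hgz, map_sub, contract_wedge hwa.symm, hfa]
    have := contract_wedge_self (R := K) a f
    rw [hfa] at this
    simpa using this
  have e2 : boundary K (contract K b g) = 0 := by
    rw [← neg_eq_zero, ← contract_boundary, hgz, map_sub, contract_wedge hwb.symm,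
      contract_wedge hab.symm, hfb]
    simp
  have support : ∀ τ, a ∉ τ → b ∉ τ →
      (insert a τ ∈ degreeComplex T α' ∨ insert b τ ∈ degreeComplex T α') →
      τ ∈ degreeComplex U α := by
    intro τ haτ hbτ hτ
    have hle : faceExponent τ ≤ α := fun v => by
      by_cases hva : v = a
      · simp [faceExponent_apply, hva, haτ]
      by_cases hvb : v = b
      · simp [faceExponent_apply, hvb, hbτ]
      rcases hτ with hτ | hτ
      · have := hτ.1 v
        rw [faceExponent_insert haτ] at this
        simpa [hα', Finsupp.single_apply, Ne.symm hva, Ne.symm hvb] using this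
      · have := hτ.1 v
        rw [faceExponent_insert hbτ] at this
        simpa [hα', Finsupp.single_apply, Ne.symm hva, Ne.symm hvb] using this
    refine ⟨hle, ?_⟩
    rcases hτ with hτ | hτ
    · have h2 := hτ.2
      rw [faceExponent_insert haτ, hα', add_right_comm, add_tsub_add_eq_tsub_right,
        ← tsub_add_eq_add_tsub hle] at h2
      rcases (hT _).1 h2 with h3 | h3
      · exact hUb _ h3
      · exact absurd (by simp [ha, hab]) h3.1
    · have h2 := hτ.2
      rw [faceExponent_insert hbτ, hα', add_tsub_add_eq_tsub_right,
        ← tsub_add_eq_add_tsub hle] at h2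
      rcases (hT _).1 h2 with h3 | h3
      · exact hUa _ h3
      · exact absurd (by simp [hb, hab.symm]) h3.2
  -- Contracting `g` at `a` fills `-f`, but may use faces through `b`. Those are dropped; the
  -- resulting error is cancelled by the symmetric term with `a` and `b` exchanged, since
  -- contractions anticommute.
  have hρ : IsChainOf (degreeComplex U α) (i + 1)
      (contract K b (wedge K b (contract K a g))) :=
    (hg.contract (Γ := {τ | a ∉ τ ∧ insert a τ ∈ degreeComplex T α'}) fun τ h1 h2 =>
      ⟨h1, h2⟩).contract_wedge fun τ h1 h2 => support τ h2.1 h1 (Or.inl h2.2)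
  have hρ' : IsChainOf (degreeComplex U α) (i + 1)
      (contract K a (wedge K a (contract K b g))) :=
    (hg.contract (Γ := {τ | b ∉ τ ∧ insert b τ ∈ degreeComplex T α'}) fun τ h1 h2 =>
      ⟨h1, h2⟩).contract_wedge fun τ h1 h2 => support τ h1 h2.1 (Or.inr h2.2)
  refine ⟨_, (hρ.add hρ').neg, ?_⟩
  rw [map_neg, map_add, boundary_contract_wedge (by rw [e1, map_neg, hfb, neg_zero]),
    boundary_contract_wedge (by rw [e2, map_zero]), e1, e2, contract_comm hab]
  abel

end MonomialRegularity

/-! ### Products of edges: divisibility and exchange properties -/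

section EdgeProducts

set_option linter.unusedSectionVars false

variable {V : Type*}

/-- `γ` is the exponent of a product of `s` edges of `G`. -/
inductive IsEdgeProduct (G : SimpleGraph V) : ℕ → (V →₀ ℕ) → Prop
  | zero : IsEdgeProduct G 0 0
  | succ {s : ℕ} {γ : V →₀ ℕ} {u v : V} (h : IsEdgeProduct G s γ) (huv : G.Adj u v) :
      IsEdgeProduct G (s + 1) (γ + Finsupp.single u 1 + Finsupp.single v 1)

variable {G : SimpleGraph V}

theorem IsEdgeProduct.succ' {s : ℕ} {γ δ : V →₀ ℕ} {u v : V} (h : IsEdgeProduct G s γ)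
    (huv : G.Adj u v) (e : γ + Finsupp.single u 1 + Finsupp.single v 1 = δ) :
    IsEdgeProduct G (s + 1) δ := e ▸ h.succ huv

theorem IsEdgeProduct.degree_eq {s : ℕ} {γ : V →₀ ℕ} (h : IsEdgeProduct G s γ) :
    γ.degree = 2 * s := by
  induction h with
  | zero => simp
  | succ h huv ih => simp [ih]; ring

theorem IsEdgeProduct.exists_of_succ {s : ℕ} {γ : V →₀ ℕ} (h : IsEdgeProduct G (s + 1) γ) :
    ∃ u v δ, G.Adj u v ∧ IsEdgeProduct G s δ ∧ γ = δ + Finsupp.single u 1 + Finsupp.single v 1 := by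
  cases h with
  | succ h huv => exact ⟨_, _, _, huv, h, rfl⟩

theorem IsEdgeProduct.extract {s : ℕ} {γ : V →₀ ℕ} (h : IsEdgeProduct G s γ) {z : V}
    (hz : γ z ≠ 0) : ∃ w δ t, s = t + 1 ∧ G.Adj z w ∧ IsEdgeProduct G t δ ∧
      γ = δ + Finsupp.single z 1 + Finsupp.single w 1 := by
  classical
  induction h with
  | zero => simp at hz
  | @succ s γ u v h huv ih =>
    by_cases hu : u = z
    · subst hu; exact ⟨v, γ, s, rfl, huv, h, rfl⟩
    by_cases hv : v = z
    · subst hv; exact ⟨u, γ, s, rfl, huv.symm, h, add_right_comm _ _ _⟩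
    obtain ⟨w, δ, t, rfl, hzw, hδ, rfl⟩ := ih (by simpa [Finsupp.single_apply, hu, hv] using hz)
    exact ⟨w, _, t + 1, rfl, hzw, hδ.succ huv, by abel⟩

theorem IsEdgeProduct.mono {G' : SimpleGraph V} (hG : G ≤ G') {s : ℕ} {γ : V →₀ ℕ}
    (h : IsEdgeProduct G s γ) : IsEdgeProduct G' s γ := by
  induction h with
  | zero => exact .zero
  | succ h huv ih => exact ih.succ (hG huv)

variable (G) in
/-- The exponents of the monomials in the `s`-th power of the edge ideal. -/
def edgePowerSet (s : ℕ) : Set (V →₀ ℕ) := {β | ∃ γ, IsEdgeProduct G s γ ∧ γ ≤ β}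

theorem isUpperSet_edgePowerSet (s : ℕ) : IsUpperSet (edgePowerSet G s) :=
  fun _ _ h ⟨γ, hγ, hle⟩ => ⟨γ, hγ, hle.trans h⟩

theorem edgePowerSet_succ_subset (s : ℕ) : edgePowerSet G (s + 1) ⊆ edgePowerSet G s := by
  rintro β ⟨γ, hγ, hle⟩
  obtain ⟨u, v, δ, -, hδ, rfl⟩ := hγ.exists_of_succ
  exact ⟨δ, hδ, le_trans (by rw [add_assoc]; exact le_self_add) hle⟩

theorem single_add_single_le {u v : V} (h : u ≠ v) {β : V →₀ ℕ} :
    Finsupp.single u 1 + Finsupp.single v 1 ≤ β ↔ β u ≠ 0 ∧ β v ≠ 0 := by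
  classical
  constructor
  · intro h'
    have h1 := h' u
    have h2 := h' v
    simp [h, h.symm] at h1 h2
    omega
  · rintro ⟨h1, h2⟩ w
    simp only [Finsupp.add_apply, Finsupp.single_apply]
    by_cases hu : u = w
    · subst hu; simp [h.symm]; omega
    · by_cases hv : v = w
      · subst hv; simp [hu]; omega
      · simp [hu, hv]

theorem mem_edgePowerSet_one {β : V →₀ ℕ} :
    β ∈ edgePowerSet G 1 ↔ ∃ u v, G.Adj u v ∧ β u ≠ 0 ∧ β v ≠ 0 := by
  constructor
  · rintro ⟨γ, hγ, hle⟩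
    obtain ⟨u, v, δ, huv, hδ, rfl⟩ := hγ.exists_of_succ
    exact ⟨u, v, huv, (single_add_single_le huv.ne).1
      (le_trans (by rw [add_assoc]; exact le_add_self) hle)⟩
  · rintro ⟨u, v, huv, h⟩
    exact ⟨_, IsEdgeProduct.zero.succ huv, by
      rw [zero_add]; exact (single_add_single_le huv.ne).2 h⟩

theorem le_of_le_add_single {A γ : V →₀ ℕ} {b : V} (h : A ≤ γ + Finsupp.single b 1)
    (hb : A b = 0) : A ≤ γ := fun v => by
  classical
  have := h v
  by_cases hv : b = v
  · subst hv; omega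
  · simpa [Finsupp.single_apply, hv] using this

/-- At most two factors of the product meet the extra a and b. If one factor suffices to absorb
them, the other s + 1 factors divide γ; otherwise the factors are au and bv, and u, v remain in γ.
-/
theorem IsEdgeProduct.mem_or_of_le_add_edge {s : ℕ} {A γ : V →₀ ℕ} {a b : V}
    (hA : IsEdgeProduct G (s + 2) A)
    (h : A ≤ γ + (Finsupp.single a 1 + Finsupp.single b 1)) :
    γ ∈ edgePowerSet G (s + 1) ∨ ∃ u v δ, G.Adj a u ∧ G.Adj b v ∧ IsEdgeProduct G s δ ∧
      δ + Finsupp.single u 1 + Finsupp.single v 1 ≤ γ := by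
  by_cases ha : A a = 0
  · have h1 : A ≤ γ + Finsupp.single b 1 := le_of_le_add_single (h.trans_eq (by abel)) ha
    by_cases hb : A b = 0
    · exact Or.inl (edgePowerSet_succ_subset _ ⟨A, hA, le_of_le_add_single h1 hb⟩)
    · obtain ⟨w, δ, t, ht, -, hδ, rfl⟩ := hA.extract hb
      obtain rfl : s + 1 = t := by omega
      rw [add_right_comm] at h1
      exact Or.inl ⟨δ, hδ, le_self_add.trans (le_of_add_le_add_right h1)⟩
  · obtain ⟨u, δ, t, ht, hau, hδ, rfl⟩ := hA.extract ha
    obtain rfl : s + 1 = t := by omega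
    have h1 : δ + Finsupp.single u 1 ≤ γ + Finsupp.single b 1 := by
      refine le_of_add_le_add_right (a := Finsupp.single a 1) ?_
      convert h using 1 <;> abel
    by_cases hb : δ b = 0
    · exact Or.inl ⟨δ, hδ, le_of_le_add_single (le_self_add.trans h1) hb⟩
    · obtain ⟨v, δ', t, ht, hbv, hδ', rfl⟩ := hδ.extract hb
      obtain rfl : s = t := by omega
      refine Or.inr ⟨u, v, δ', hau, hbv, hδ', ?_⟩
      refine le_of_add_le_add_right (a := Finsupp.single b 1) ?_
      convert h1 using 1; abel

/-- An alternating walk from p, as in matching theory: take an edge pz of A, then an edge zw of B,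
and continue from w with these two edges removed. If the walk ends on an edge of A, switching
augments B; if it ends on an edge of B, switching trades p for an endpoint q in which B is in
excess. -/
theorem IsEdgeProduct.exchange {k m : ℕ} {A B : V →₀ ℕ} (hA : IsEdgeProduct G m A)
    (hB : IsEdgeProduct G k B) {p : V} (hp : B p < A p) :
    (∃ p', Finsupp.single p 1 + Finsupp.single p' 1 ≤ A - B ∧
      IsEdgeProduct G (k + 1) (B + Finsupp.single p 1 + Finsupp.single p' 1)) ∨
    ∃ q A' B', A q < B q ∧ IsEdgeProduct G k B' ∧
      B' + Finsupp.single q 1 = B + Finsupp.single p 1 ∧ IsEdgeProduct G m A' ∧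
      A' + Finsupp.single p 1 = A + Finsupp.single q 1 := by
  classical
  induction k generalizing m A B p with
  | zero =>
    cases hB
    obtain ⟨z, δ, t, rfl, hpz, hδ, rfl⟩ := hA.extract (z := p) (by simp at hp; omega)
    exact Or.inl ⟨z, by rw [tsub_zero, add_assoc]; exact le_add_self, IsEdgeProduct.zero.succ hpz⟩
  | succ k ih =>
    obtain ⟨z, A₁, m, rfl, hpz, hA₁, rfl⟩ := hA.extract (z := p) (by omega)
    by_cases hz : B z < (A₁ + Finsupp.single p 1 + Finsupp.single z 1 : V →₀ ℕ) z
    · refine Or.inl ⟨z, (single_add_single_le hpz.ne).2 ⟨?_, ?_⟩, hB.succ hpz⟩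
      · rw [Finsupp.tsub_apply]; omega
      · rw [Finsupp.tsub_apply]; omega
    obtain ⟨w, B₁, k', hk, hzw, hB₁, rfl⟩ := hB.extract (z := z) (by
      have : (A₁ + Finsupp.single p 1 + Finsupp.single z 1 : V →₀ ℕ) z ≠ 0 := by simp
      omega)
    obtain rfl : k = k' := by omega
    by_cases hw : (A₁ + Finsupp.single p 1 + Finsupp.single z 1 : V →₀ ℕ) w <
        (B₁ + Finsupp.single z 1 + Finsupp.single w 1 : V →₀ ℕ) w
    · exact Or.inr ⟨w, _, _, hw, hB₁.succ hpz, by abel, hA₁.succ hzw.symm, by abel⟩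
    have hw1 : B₁ w < A₁ w := by
      have hzw' := hzw.ne
      have hpz' := hpz.ne
      by_cases hpw : p = w
      · subst hpw; simp [hzw'] at hp ⊢; omega
      · simp [hpw, hzw'] at hw; omega
    rcases ih hA₁ hB₁ hw1 with ⟨p', hp', hprod⟩ | ⟨q, A', B', hq, hB', eB, hA', eA⟩
    · refine Or.inl ⟨p', fun v => ?_, hprod.succ' hpz (by abel)⟩
      have h1 := hp' v
      by_cases hvp : p = v
      · subst hvp
        simp only [Finsupp.add_apply, Finsupp.tsub_apply, Finsupp.single_apply] at h1 hp ⊢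
        split_ifs at h1 hp ⊢ <;> omega
      · simp only [Finsupp.add_apply, Finsupp.tsub_apply, Finsupp.single_apply, hvp, if_false]
          at h1 ⊢
        split_ifs at h1 ⊢ <;> omega
    · refine Or.inr ⟨q, _, _, ?_, hB'.succ hpz, ?_, hA'.succ hzw.symm, ?_⟩
      · by_cases hqp : p = q
        · subst hqp
          simp only [Finsupp.add_apply, Finsupp.single_apply] at hp ⊢
          split_ifs at hp ⊢ <;> omega
        · simp only [Finsupp.add_apply, Finsupp.single_apply, hqp, if_false]
          split_ifs <;> omega
      · calc _ = (B' + Finsupp.single q 1) + Finsupp.single p 1 + Finsupp.single z 1 := by abel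
          _ = _ := by rw [eB]; abel
      · calc _ = (A' + Finsupp.single w 1) + Finsupp.single z 1 + Finsupp.single p 1 := by abel
          _ = _ := by rw [eA]; abel

/-- Exchange is applied repeatedly to `A`: each trade lowers the excess of `A` over `B`, and since
`A` has larger degree the process must end in an augmentation. -/
theorem IsEdgeProduct.augment {k m : ℕ} (hkm : k < m) {A B : V →₀ ℕ} (hA : IsEdgeProduct G m A)
    (hB : IsEdgeProduct G k B) :
    ∃ p p', Finsupp.single p 1 + Finsupp.single p' 1 ≤ A - B ∧
      IsEdgeProduct G (k + 1) (B + Finsupp.single p 1 + Finsupp.single p' 1) := by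
  classical
  generalize hn : (A - B).degree = n
  induction n using Nat.strong_induction_on generalizing A with
  | _ n ih =>
    obtain ⟨p, hp⟩ : ∃ p, B p < A p := by
      by_contra! h
      have : A.degree ≤ B.degree := by
        have hle : A ≤ B := h
        rw [← add_tsub_cancel_of_le hle, map_add]; exact Nat.le_add_right _ _
      rw [hA.degree_eq, hB.degree_eq] at this
      omega
    rcases hA.exchange hB hp with ⟨p', h⟩ | ⟨q, A', -, hq, -, -, hA', eA⟩
    · exact ⟨p, p', h⟩
    have e : A - B = (A' - B) + Finsupp.single p 1 := by
      ext v
      have h1 := DFunLike.congr_fun eA v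
      simp only [Finsupp.add_apply, Finsupp.tsub_apply, Finsupp.single_apply] at h1 ⊢
      by_cases hpv : p = v
      · subst hpv
        have : q ≠ p := fun h => by subst h; omega
        simp only [this, if_false, if_true] at h1 ⊢; omega
      · by_cases hqv : q = v
        · subst hqv; simp only [hpv, if_false, if_true] at h1 ⊢; omega
        · simp only [hpv, hqv, if_false] at h1 ⊢; omega
    obtain ⟨p₁, p₂, h1, h2⟩ := ih (A' - B).degree (by rw [← hn, e]; simp) hA' rfl
    exact ⟨p₁, p₂, h1.trans (by rw [e]; exact le_self_add), h2⟩

end EdgeProducts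

/-! ### The square of an edge ideal, and the passage from a power to the next -/

section EdgePowers

set_option linter.unusedSectionVars false

variable {V : Type*} [LinearOrder V] [Fintype V] {K : Type*} [Field K] {G : SimpleGraph V}

/-- The product γ is a generator of least degree, so its degree complex consists of the empty face
alone and has nonzero reduced homology there. -/
theorem two_mul_le_of_monomialRegLE {s : ℕ} {γ : V →₀ ℕ} (hγ : IsEdgeProduct G s γ) {r : ℤ}
    (h : MonomialRegLE K (edgePowerSet G s) r) : 2 * (s : ℤ) ≤ r := by
  classical
  by_contra! hr
  obtain ⟨g, hg, hg'⟩ := h γ 0 (by rw [hγ.degree_eq]; push_cast; omega)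
    (Pi.single ∅ 1) (fun τ hτ => by
      by_cases h' : τ = ∅
      · subst h'
        refine ⟨⟨by simp [faceExponent_empty], γ, hγ, by simp [faceExponent_empty]⟩, rfl⟩
      · simp [h'] at hτ) (IsChainOf.boundary_zero (Δ := Set.univ) fun τ hτ => by
      by_cases h' : τ = ∅
      · subst h'; simp
      · simp [h'] at hτ)
  have hg0 : g = 0 := by
    ext τ
    by_contra h'
    obtain ⟨⟨h1, δ, hδ, h2⟩, h3⟩ := hg τ h'
    have h4 : δ.degree ≤ (γ - faceExponent τ).degree := by
      conv_rhs => rw [← add_tsub_cancel_of_le h2, map_add]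
      exact Nat.le_add_right _ _
    have h5 := degree_tsub_of_le h1
    rw [hδ.degree_eq] at h4
    rw [hγ.degree_eq, degree_faceExponent, h3] at h5
    omega
  rw [hg0, map_zero] at hg'
  simpa using congr_fun hg' ∅

theorem MonomialRegLE.edge_union_neighbors {a b : V} (hab : G.Adj a b) {r : ℤ}
    (h : MonomialRegLE K (edgePowerSet G 1) r) {W : Set V} (ha : G.neighborSet a ⊆ W)
    (hb : G.neighborSet b ⊆ W) : MonomialRegLE K (edgePowerSet G 1 ∪ variableSet W) (r - 1) := by
  classical
  have h2 : 2 ≤ r := by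
    simpa using two_mul_le_of_monomialRegLE (IsEdgeProduct.zero.succ hab) h
  have hT := h.union_variableSet (isUpperSet_edgePowerSet 1) (by omega) (W \ {a, b})
  -- The part free of `a` and `b`. Adjoining the variables in `W \ {a, b}` to I gives `U` plus the
  -- single edge ab, because any other edge at `a` or `b` has its far end in `W`; hence `U` gains
  -- one in regularity.
  set U : Set (V →₀ ℕ) := {β | (∃ w ∈ W, w ≠ a ∧ w ≠ b ∧ β w ≠ 0) ∨
    ∃ u v, G.Adj u v ∧ u ≠ a ∧ u ≠ b ∧ v ≠ a ∧ v ≠ b ∧ β u ≠ 0 ∧ β v ≠ 0} with hU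
  have hmono : ∀ {β γ : V →₀ ℕ}, β ≤ γ → ∀ {v}, β v ≠ 0 → γ v ≠ 0 := fun h v h' => by
    have := h v; omega
  have hUup : IsUpperSet U := by
    rintro β γ hβγ (⟨w, h1, h2, h3, h4⟩ | ⟨u, v, h1, h2, h3, h4, h5, h6, h7⟩)
    · exact Or.inl ⟨w, h1, h2, h3, hmono hβγ h4⟩
    · exact Or.inr ⟨u, v, h1, h2, h3, h4, h5, hmono hβγ h6, hmono hβγ h7⟩
  have key : ∀ {β : V →₀ ℕ} {u v : V}, G.Adj u v → β u ≠ 0 → β v ≠ 0 →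
      β ∈ U ∨ β a ≠ 0 ∧ β b ≠ 0 := by
    intro β u v huv hu hv
    by_cases h1 : u = a
    · subst h1
      by_cases h2 : v = b
      · subst h2; exact Or.inr ⟨hu, hv⟩
      · exact Or.inl (Or.inl ⟨v, ha huv, huv.ne', h2, hv⟩)
    by_cases h2 : u = b
    · subst h2
      by_cases h3 : v = a
      · subst h3; exact Or.inr ⟨hv, hu⟩
      · exact Or.inl (Or.inl ⟨v, hb huv, h3, huv.ne', hv⟩)
    by_cases h3 : v = a
    · subst h3; exact Or.inl (Or.inl ⟨u, ha huv.symm, h1, h2, hu⟩)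
    by_cases h4 : v = b
    · subst h4; exact Or.inl (Or.inl ⟨u, hb huv.symm, h1, h2, hu⟩)
    exact Or.inl (Or.inr ⟨u, v, huv, h1, h2, h3, h4, hu, hv⟩)
  have hUr : MonomialRegLE K U (r - 1) := by
    refine MonomialRegLE.of_union_edge hUup ?_ hab.ne ?_ ?_ ?_ hT
    · rintro (⟨w, -, -, -, h⟩ | ⟨u, v, -, -, -, -, -, h, -⟩) <;> simp at h
    · intro β
      constructor
      · rintro (h | ⟨w, ⟨hw, hw'⟩, h⟩)
        · obtain ⟨u, v, huv, hu, hv⟩ := mem_edgePowerSet_one.1 h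
          exact key huv hu hv
        · simp only [Set.mem_insert_iff, Set.mem_singleton_iff, not_or] at hw'
          exact Or.inl (Or.inl ⟨w, hw, hw'.1, hw'.2, h⟩)
      · rintro ((⟨w, h1, h2, h3, h4⟩ | ⟨u, v, h1, -, -, -, -, h6, h7⟩) | ⟨h1, h2⟩)
        · exact Or.inr ⟨w, ⟨h1, by simp [h2, h3]⟩, h4⟩
        · exact Or.inl (mem_edgePowerSet_one.2 ⟨u, v, h1, h6, h7⟩)
        · exact Or.inl (mem_edgePowerSet_one.2 ⟨a, b, hab, h1, h2⟩)
    · rintro β (⟨w, h1, h2, h3, h4⟩ | ⟨u, v, h1, h2, h3, h4, h5, h6, h7⟩)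
      · exact Or.inl ⟨w, h1, h2, h3, by simpa [Finsupp.single_apply, h2.symm] using h4⟩
      · exact Or.inr ⟨u, v, h1, h2, h3, h4, h5, by simpa [Finsupp.single_apply, h2.symm] using h6,
          by simpa [Finsupp.single_apply, h4.symm] using h7⟩
    · rintro β (⟨w, h1, h2, h3, h4⟩ | ⟨u, v, h1, h2, h3, h4, h5, h6, h7⟩)
      · exact Or.inl ⟨w, h1, h2, h3, by simpa [Finsupp.single_apply, h3.symm] using h4⟩
      · exact Or.inr ⟨u, v, h1, h2, h3, h4, h5, by simpa [Finsupp.single_apply, h3.symm] using h6,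
          by simpa [Finsupp.single_apply, h5.symm] using h7⟩
  -- Since `a` and `b` are neighbours of each other, both lie in `W`, and as variables they absorb
  -- the edge ab.
  have e : edgePowerSet G 1 ∪ variableSet W = U ∪ variableSet {a, b} := by
    ext β
    constructor
    · rintro (h | ⟨w, hw, h⟩)
      · obtain ⟨u, v, huv, hu, hv⟩ := mem_edgePowerSet_one.1 h
        rcases key huv hu hv with h | h
        · exact Or.inl h
        · exact Or.inr ⟨a, by simp, h.1⟩
      · by_cases h1 : w = a
        · exact Or.inr ⟨w, by simp [h1], h⟩
        by_cases h2 : w = b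
        · exact Or.inr ⟨w, by simp [h2], h⟩
        exact Or.inl (Or.inl ⟨w, hw, h1, h2, h⟩)
    · rintro ((⟨w, h1, h2, h3, h4⟩ | ⟨u, v, h1, -, -, -, -, h6, h7⟩) | ⟨w, hw, h⟩)
      · exact Or.inr ⟨w, h1, h4⟩
      · exact Or.inl (mem_edgePowerSet_one.2 ⟨u, v, h1, h6, h7⟩)
      · rcases hw with rfl | rfl
        · exact Or.inr ⟨_, hb hab.symm, h⟩
        · exact Or.inr ⟨_, ha hab, h⟩
  rw [e]
  exact hUr.union_variableSet hUup (by omega) _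

variable (G) in
/-- The exponents of the monomials divisible by a product of a neighbor of `a` and a neighbor
of `b`. -/
def neighborProducts (a b : V) : Set (V →₀ ℕ) :=
  {β | ∃ u v, G.Adj a u ∧ G.Adj b v ∧ Finsupp.single u 1 + Finsupp.single v 1 ≤ β}

theorem monomialColon_edgePowerSet_two {a b : V} (hab : G.Adj a b) :
    monomialColon (edgePowerSet G 2) (Finsupp.single a 1 + Finsupp.single b 1) =
      edgePowerSet G 1 ∪ neighborProducts G a b := by
  ext β
  constructor
  · rintro ⟨A, hA, hle⟩
    rcases hA.mem_or_of_le_add_edge hle with h | ⟨u, v, δ, hu, hv, -, h⟩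
    · exact Or.inl h
    · exact Or.inr ⟨u, v, hu, hv, le_trans (by rw [add_assoc]; exact le_add_self) h⟩
  · rintro (⟨γ, hγ, hle⟩ | ⟨u, v, hu, hv, hle⟩)
    · exact ⟨_, hγ.succ hab, by rw [add_assoc]; gcongr⟩
    · refine ⟨_, (IsEdgeProduct.zero.succ hu).succ hv, ?_⟩
      calc _ = (Finsupp.single u 1 + Finsupp.single v 1) +
            (Finsupp.single a 1 + Finsupp.single b 1) := by abel
        _ ≤ _ := by gcongr

theorem monomialColon_edgePowerSet_one (a : V) :
    monomialColon (edgePowerSet G 1) (Finsupp.single a 1) =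
      edgePowerSet G 1 ∪ variableSet (G.neighborSet a) := by
  classical
  ext β
  rw [mem_monomialColon, Set.mem_union, mem_edgePowerSet_one, mem_edgePowerSet_one]
  constructor
  · rintro ⟨u, v, huv, hu, hv⟩
    by_cases h1 : a = u
    · subst h1
      exact Or.inr ⟨v, huv, by simpa [Finsupp.single_apply, huv.ne] using hv⟩
    by_cases h2 : a = v
    · subst h2
      exact Or.inr ⟨u, huv.symm, by simpa [Finsupp.single_apply, huv.ne'] using hu⟩
    exact Or.inl ⟨u, v, huv, by simpa [Finsupp.single_apply, h1] using hu,
      by simpa [Finsupp.single_apply, h2] using hv⟩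
  · rintro (⟨u, v, huv, hu, hv⟩ | ⟨w, hw, h⟩)
    · exact ⟨u, v, huv, by simp [hu], by simp [hv]⟩
    · exact ⟨a, w, hw, by simp, by simp [h]⟩

theorem isUpperSet_neighborProducts (a b : V) : IsUpperSet (neighborProducts G a b) :=
  fun _ _ h ⟨u, v, hu, hv, hle⟩ => ⟨u, v, hu, hv, hle.trans h⟩

theorem MonomialRegLE.colon_edge {a b : V} (hab : G.Adj a b) {r : ℤ}
    (h : MonomialRegLE K (edgePowerSet G 1) r) :
    MonomialRegLE K (monomialColon (edgePowerSet G 2) (Finsupp.single a 1 + Finsupp.single b 1))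
      r := by
  classical
  rw [monomialColon_edgePowerSet_two hab]
  have hI := isUpperSet_edgePowerSet (G := G) 1
  set J := edgePowerSet G 1 ∪ neighborProducts G a b with hJ
  have hJup : IsUpperSet J := hI.union (isUpperSet_neighborProducts a b)
  -- Common neighbours c, which contribute the squares c², are split off one by one. The colon by c
  -- contains all of N(a), N(b) and N(c) as variables, so its bound `r - 1` pays for the degree of
  -- c.
  have key : ∀ s : Finset V, (s : Set V) ⊆ G.neighborSet a ∩ G.neighborSet b →
      MonomialRegLE K (J ∪ variableSet (s : Set V)) r → MonomialRegLE K J r := by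
    intro s
    induction s using Finset.induction_on with
    | empty => intro _ h; simpa [variableSet] using h
    | insert c s hc ih =>
      intro hs h'
      have hca : G.Adj a c := (hs (Finset.mem_coe.2 (Finset.mem_insert_self c s))).1
      have hcb : G.Adj b c := (hs (Finset.mem_coe.2 (Finset.mem_insert_self c s))).2
      have hs' : (s : Set V) ⊆ G.neighborSet a ∩ G.neighborSet b :=
        fun x hx => hs (by simp [Finset.mem_coe.1 hx])
      refine ih hs' (MonomialRegLE.of_colon (hJup.union (isUpperSet_variableSet _))
        (Finsupp.single c 1) ?_ ?_)
      · have e : monomialColon (J ∪ variableSet (s : Set V)) (Finsupp.single c 1) =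
            edgePowerSet G 1 ∪ variableSet
              (G.neighborSet a ∪ G.neighborSet b ∪ G.neighborSet c) := by
          have hne : ∀ {β : V →₀ ℕ} {x : V}, x ≠ c → (β + Finsupp.single c 1 : V →₀ ℕ) x ≠ 0 → β x ≠ 0 := by
            intro β x hx h; simpa [Finsupp.single_apply, hx.symm] using h
          ext β
          constructor
          · rintro ((h | ⟨u, v, hu, hv, hle⟩) | ⟨w, hw, hβ⟩)
            · have : β ∈ monomialColon (edgePowerSet G 1) (Finsupp.single c 1) := h
              rw [monomialColon_edgePowerSet_one] at this
              rcases this with h | ⟨w, hw, hβ⟩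
              · exact Or.inl h
              · exact Or.inr ⟨w, Or.inr hw, hβ⟩
            · by_cases huc : u = c
              · by_cases hvc : v = c
                · subst huc; subst hvc
                  refine Or.inr ⟨v, Or.inl (Or.inl hu), ?_⟩
                  have := hle v
                  simp at this; omega
                · refine Or.inr ⟨v, Or.inl (Or.inr hv), hne hvc ?_⟩
                  have := hle v
                  simp only [Finsupp.add_apply, Finsupp.single_eq_same] at this ⊢; omega
              · refine Or.inr ⟨u, Or.inl (Or.inl hu), hne huc ?_⟩
                have := hle u
                simp only [Finsupp.add_apply, Finsupp.single_eq_same] at this ⊢; omega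
            · exact Or.inr ⟨w, Or.inl (Or.inl (hs' hw).1),
                hne (fun h => hc (h ▸ Finset.mem_coe.1 hw)) hβ⟩
          · have hone : ∀ {β : V →₀ ℕ} {w : V}, β w ≠ 0 → Finsupp.single w 1 ≤ β := by
              intro β w h; rw [Finsupp.single_le_iff]; omega
            rintro (h | ⟨w, (hw | hw) | hw, hβ⟩)
            · exact Or.inl (Or.inl (hI le_self_add h))
            · exact Or.inl (Or.inr ⟨w, c, hw, hcb, by gcongr; exact hone hβ⟩)
            · exact Or.inl (Or.inr ⟨c, w, hca, hw, by rw [add_comm]; gcongr; exact hone hβ⟩)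
            · exact Or.inl (Or.inl (mem_edgePowerSet_one.2 ⟨c, w, hw, by simp, by simp [hβ]⟩))
        rw [e]
        rw [Finsupp.degree_single, Nat.cast_one]
        exact h.edge_union_neighbors hab (fun x hx => Or.inl (Or.inl hx))
          (fun x hx => Or.inl (Or.inr hx))
      · convert h' using 1
        ext β
        simp [variableSet, Nat.one_le_iff_ne_zero, Finsupp.single_le_iff]
        rw [or_assoc, or_comm (a := ¬ β c = 0)]
  refine key (Set.toFinite (G.neighborSet a ∩ G.neighborSet b)).toFinset (by simp) ?_
  -- With the common neighbours present, the ideal is (I : a) ∩ (I : b); the sum of these two is I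
  -- plus N(a) and N(b), with the bound `r - 1` that Mayer–Vietoris requires.
  have e : J ∪ variableSet (G.neighborSet a ∩ G.neighborSet b) =
      (edgePowerSet G 1 ∪ variableSet (G.neighborSet a)) ∩
        (edgePowerSet G 1 ∪ variableSet (G.neighborSet b)) := by
    ext β
    constructor
    · rintro ((h | ⟨u, v, hu, hv, hle⟩) | ⟨w, ⟨h1, h2⟩, h⟩)
      · exact ⟨Or.inl h, Or.inl h⟩
      · refine ⟨Or.inr ⟨u, hu, ?_⟩, Or.inr ⟨v, hv, ?_⟩⟩
        · have := hle u
          simp only [Finsupp.add_apply, Finsupp.single_eq_same] at this; omega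
        · have := hle v
          simp only [Finsupp.add_apply, Finsupp.single_eq_same] at this; omega
      · exact ⟨Or.inr ⟨w, h1, h⟩, Or.inr ⟨w, h2, h⟩⟩
    · rintro ⟨h | ⟨u, hu, h⟩, h' | ⟨v, hv, h'⟩⟩
      · exact Or.inl (Or.inl h)
      · exact Or.inl (Or.inl h)
      · exact Or.inl (Or.inl h')
      · by_cases huv : u = v
        · subst huv; exact Or.inr ⟨u, ⟨hu, hv⟩, h⟩
        · exact Or.inl (Or.inr ⟨u, v, hu, hv, (single_add_single_le huv).2 ⟨h, h'⟩⟩)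
  rw [Set.Finite.coe_toFinset, e]
  refine MonomialRegLE.inter (hI.union (isUpperSet_variableSet _))
    (hI.union (isUpperSet_variableSet _)) ?_ ?_ ?_
  · rw [← monomialColon_edgePowerSet_one]; exact h.colon_single hI a
  · rw [← monomialColon_edgePowerSet_one]; exact h.colon_single hI b
  · convert h.edge_union_neighbors hab (W := G.neighborSet a ∪ G.neighborSet b)
      Set.subset_union_left Set.subset_union_right using 1
    ext β
    constructor
    · rintro ((h | ⟨w, h1, h2⟩) | (h | ⟨w, h1, h2⟩))
      · exact Or.inl h
      · exact Or.inr ⟨w, Or.inl h1, h2⟩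
      · exact Or.inl h
      · exact Or.inr ⟨w, Or.inr h1, h2⟩
    · rintro (h | ⟨w, h1 | h1, h2⟩)
      · exact Or.inl (Or.inl h)
      · exact Or.inl (Or.inr ⟨w, h1, h2⟩)
      · exact Or.inr (Or.inr ⟨w, h1, h2⟩)

/-- The lexicographic order of the generators of a power of the edge ideal has the property that
successive colon ideals are obtained from those of the next power by adding variables. -/
theorem MonomialRegLE.edgePowerSet_succ {s : ℕ} {r : ℤ} (hr : 1 ≤ r)
    (h₁ : ∀ m, IsEdgeProduct G s m →
      MonomialRegLE K (monomialColon (edgePowerSet G (s + 1)) m) r)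
    (h₂ : MonomialRegLE K (edgePowerSet G s) (r + 2 * s)) :
    MonomialRegLE K (edgePowerSet G (s + 1)) (r + 2 * s) := by
  classical
  have hfin : {γ : Lex (V →₀ ℕ) | IsEdgeProduct G s (ofLex γ)}.Finite := by
    have : {γ : V →₀ ℕ | IsEdgeProduct G s γ}.Finite := by
      refine (Set.finite_Iic (Finsupp.equivFunOnFinite.symm fun _ : V => 2 * s)).subset ?_
      intro γ hγ v
      have : γ v ≤ γ.degree := by
        rw [degree_eq_sum_univ]
        exact Finset.single_le_sum (f := fun v => γ v) (fun _ _ => Nat.zero_le _)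
          (Finset.mem_univ v)
      rw [(show IsEdgeProduct G s γ from hγ).degree_eq] at this
      exact this
    exact this
  have hP := isUpperSet_edgePowerSet (G := G) (s + 1)
  -- I^(s+1) together with the generators of I^s outside `T`. As `T` grows through initial segments,
  -- this descends from I^s to I^(s+1).
  set X : Finset (Lex (V →₀ ℕ)) → Set (V →₀ ℕ) := fun T =>
    edgePowerSet G (s + 1) ∪ {β | ∃ γ : Lex (V →₀ ℕ), γ ∉ T ∧ IsEdgeProduct G s (ofLex γ) ∧
      ofLex γ ≤ β} with hX
  have hXup : ∀ T, IsUpperSet (X T) := fun T => hP.union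
    fun _ _ h ⟨γ, h1, h2, h3⟩ => ⟨γ, h1, h2, h3.trans h⟩
  have key : ∀ T : Finset (Lex (V →₀ ℕ)), (∀ x ∈ T, IsEdgeProduct G s (ofLex x)) →
      (∀ x ∈ T, ∀ γ, IsEdgeProduct G s (ofLex γ) → γ < x → γ ∈ T) →
      MonomialRegLE K (X T) (r + 2 * s) := by
    intro T
    induction T using Finset.induction_on_max with
    | empty =>
      intro _ _
      convert h₂ using 1
      ext β
      constructor
      · rintro (h | ⟨γ, -, h, h'⟩)
        · exact edgePowerSet_succ_subset s h
        · exact ⟨_, h, h'⟩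
      · rintro ⟨γ, h, h'⟩
        exact Or.inr ⟨toLex γ, by simp, h, h'⟩
    | insert a T hmax ih =>
      intro hT hlow
      have ha := hT a (Finset.mem_insert_self a T)
      have haT : a ∉ T := fun h => lt_irrefl _ (hmax a h)
      have hTlow : ∀ x ∈ T, ∀ γ, IsEdgeProduct G s (ofLex γ) → γ < x → γ ∈ T := by
        intro x hx γ hγ hlt
        rcases Finset.mem_insert.1 (hlow x (Finset.mem_insert_of_mem hx) γ hγ hlt) with h | h
        · subst h; exact absurd hlt (hmax x hx).not_gt
        · exact h
      have hgt : ∀ γ : Lex (V →₀ ℕ), IsEdgeProduct G s (ofLex γ) →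
          (γ ∉ insert a T ↔ a < γ) := by
        intro γ hγ
        constructor
        · intro h
          rcases lt_trichotomy γ a with h1 | h1 | h1
          · exact absurd (hlow a (Finset.mem_insert_self a T) γ hγ h1) h
          · exact absurd (by simp [h1]) h
          · exact h1
        · intro h h'
          rcases Finset.mem_insert.1 h' with h1 | h1
          · exact lt_irrefl _ (h1 ▸ h)
          · exact lt_asymm h (hmax γ h1)
      refine MonomialRegLE.of_colon (hXup _) (ofLex a) ?_ ?_
      · rw [ha.degree_eq]
        have e : monomialColon (X (insert a T)) (ofLex a) =
            monomialColon (edgePowerSet G (s + 1)) (ofLex a) ∪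
              variableSet {p | ∃ γ : Lex (V →₀ ℕ), γ ∉ insert a T ∧ IsEdgeProduct G s (ofLex γ) ∧
                ofLex γ ≤ Finsupp.single p 1 + ofLex a} := by
          ext β
          constructor
          · rintro (h | ⟨γ, h1, h2, h3⟩)
            · exact Or.inl h
            have hlt := (hgt γ h2).1 h1
            obtain ⟨p, hp, hp'⟩ := Finsupp.Lex.lt_iff.1 hlt
            -- Exchange at the first index `p` where γ exceeds the current generator. Augmentation
            -- gives a monomial of I^(s+1). A trade gives the generator `B'`, obtained by replacing
            -- a later `q` by `p`; it is lexicographically larger, so it is still present, and it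
            -- contributes the variable `p` to the colon.
            rcases h2.exchange ha hp' with ⟨p', hle, hprod⟩ | ⟨q, A', B', hq, hB', eB, -, -⟩
            · refine Or.inl ⟨_, hprod, ?_⟩
              have : ofLex γ - ofLex a ≤ β := tsub_le_iff_right.2 h3
              rw [add_assoc, add_comm (ofLex a)]
              gcongr
              exact hle.trans this
            · have hpq : p < q := by
                rcases lt_trichotomy p q with h | h | h
                · exact h
                · subst h; exact absurd hq hp'.not_gt
                · have := hp q h
                  exact absurd hq (by rw [this]; exact lt_irrefl _)
              refine Or.inr ⟨p, ⟨toLex B', ?_, hB', ?_⟩, ?_⟩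
              · refine (hgt _ hB').2 (Finsupp.Lex.lt_iff.2 ⟨p, fun d hd => ?_, ?_⟩)
                · have := DFunLike.congr_fun eB d
                  simp [hd.ne', (hd.trans hpq).ne'] at this
                  exact this.symm
                · have := DFunLike.congr_fun eB p
                  simp [hpq.ne'] at this
                  change ofLex a p < B' p
                  omega
              · rw [add_comm, ← eB]; exact le_self_add
              · have := h3 p
                simp only [Finsupp.add_apply] at this
                intro h0
                have h4 : (ofLex a) p < (ofLex γ) p := hp'
                omega
          · rintro (h | ⟨p, ⟨γ, h1, h2, h3⟩, h⟩)
            · exact Or.inl h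
            · refine Or.inr ⟨γ, h1, h2, h3.trans ?_⟩
              gcongr
              rw [Finsupp.single_le_iff]; omega
        rw [e]
        have := (h₁ _ ha).union_variableSet (isUpperSet_monomialColon hP _) hr
          {p | ∃ γ : Lex (V →₀ ℕ), γ ∉ insert a T ∧ IsEdgeProduct G s (ofLex γ) ∧
                ofLex γ ≤ Finsupp.single p 1 + ofLex a}
        simpa using this
      · convert ih (fun x hx => hT x (Finset.mem_insert_of_mem hx)) hTlow using 1
        ext β
        constructor
        · rintro ((h | ⟨γ, h1, h2, h3⟩) | h)
          · exact Or.inl h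
          · exact Or.inr ⟨γ, fun h' => h1 (Finset.mem_insert_of_mem h'), h2, h3⟩
          · exact Or.inr ⟨a, haT, ha, h⟩
        · rintro (h | ⟨γ, h1, h2, h3⟩)
          · exact Or.inl (Or.inl h)
          · by_cases hγ : γ = a
            · subst hγ; exact Or.inr h3
            · exact Or.inl (Or.inr ⟨γ, by simp [hγ, h1], h2, h3⟩)
  have := key hfin.toFinset (by simp) (fun x _ γ hγ _ => by simpa using hγ)
  convert this using 1
  refine (Set.union_eq_left.2 ?_).symm
  rintro β ⟨γ, h1, h2, -⟩
  exact absurd (by simpa using h2) h1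

theorem MonomialRegLE.edgePowerSet_two {a b : V} (hab : G.Adj a b) {r : ℤ}
    (h : MonomialRegLE K (edgePowerSet G 1) r) :
    MonomialRegLE K (edgePowerSet G 2) (r + 2) := by
  have h2 : 2 ≤ r := by
    simpa using two_mul_le_of_monomialRegLE (IsEdgeProduct.zero.succ hab) h
  have := MonomialRegLE.edgePowerSet_succ (K := K) (G := G) (s := 1) (r := r) (by omega) ?_ ?_
  · simpa using this
  · intro m hm
    obtain ⟨u, v, δ, huv, hδ, rfl⟩ := hm.exists_of_succ
    cases hδ
    rw [zero_add]
    exact h.colon_edge huv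
  · exact fun α i hi => h α i (by push_cast at hi; omega)

end EdgePowers

/-! ### Bipartite graphs: colons of higher powers as colons of a joined graph -/

section Bipartite

set_option linter.unusedSectionVars false

variable {V : Type*} [LinearOrder V] [Fintype V] {K : Type*} [Field K] {G : SimpleGraph V}

variable (G) in
/-- The graph obtained by joining the neighbors of `a` with the neighbors of `b`. -/
def neighborJoin (a b : V) : SimpleGraph V :=
  G ⊔ SimpleGraph.fromRel fun x y => G.Adj a x ∧ G.Adj b y

theorem le_neighborJoin (a b : V) : G ≤ neighborJoin G a b := le_sup_left

theorem neighborJoin_adj {a b x y : V} : (neighborJoin G a b).Adj x y ↔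
    G.Adj x y ∨ x ≠ y ∧ (G.Adj a x ∧ G.Adj b y ∨ G.Adj a y ∧ G.Adj b x) := by
  simp [neighborJoin]

theorem neighborJoin_ne {κ : V → Bool} (hκ : ∀ u v, G.Adj u v → κ u ≠ κ v) {a b : V}
    (hab : G.Adj a b) (u v : V) (h : (neighborJoin G a b).Adj u v) : κ u ≠ κ v := by
  have h0 := hκ a b hab
  rcases neighborJoin_adj.1 h with h | ⟨-, ⟨h1, h2⟩ | ⟨h1, h2⟩⟩
  · exact hκ u v h
  all_goals
    have h1' := hκ _ _ h1
    have h2' := hκ _ _ h2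
    revert h0 h1' h2'
    cases κ a <;> cases κ b <;> cases κ u <;> cases κ v <;> simp

theorem sum_add_single (s : Finset V) (γ : V →₀ ℕ) (u v : V) :
    ∑ x ∈ s, (γ + Finsupp.single u 1 + Finsupp.single v 1 : V →₀ ℕ) x =
      ∑ x ∈ s, γ x + (if u ∈ s then 1 else 0) + (if v ∈ s then 1 else 0) := by
  simp [Finset.sum_add_distrib, Finsupp.single_apply]

theorem IsEdgeProduct.sum_color {κ : V → Bool} (hκ : ∀ u v, G.Adj u v → κ u ≠ κ v) {s : ℕ}
    {γ : V →₀ ℕ} (h : IsEdgeProduct G s γ) (c : Bool) : ∑ x with κ x = c, γ x = s := by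
  induction h with
  | zero => simp
  | @succ s γ u v h huv ih =>
    rw [sum_add_single, ih]
    have := hκ u v huv
    simp only [Finset.mem_filter, Finset.mem_univ, true_and]
    cases hu : κ u <;> cases hv : κ v <;> cases c <;> simp_all

open Classical in
-- Only the factors that are edges of G are kept, in B. The t new edges are remembered through the
-- number of endpoints they place in N(a) and in N(b).
theorem IsEdgeProduct.exists_of_neighborJoin {a b : V} {s : ℕ} {γ : V →₀ ℕ}
    (h : IsEdgeProduct (neighborJoin G a b) s γ) :
    ∃ k t B, k + t = s ∧ IsEdgeProduct G k B ∧ B ≤ γ ∧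
      t ≤ ∑ x with G.Adj a x, (γ - B) x ∧ t ≤ ∑ x with G.Adj b x, (γ - B) x := by
  induction h with
  | zero => exact ⟨0, 0, 0, rfl, .zero, le_rfl, by simp, by simp⟩
  | @succ s γ u v h huv ih =>
    obtain ⟨k, t, B, rfl, hB, hle, h1, h2⟩ := ih
    have e : γ + Finsupp.single u 1 + Finsupp.single v 1 - B =
        (γ - B) + Finsupp.single u 1 + Finsupp.single v 1 := by
      rw [add_assoc, add_assoc, tsub_add_eq_add_tsub hle]
    have e' : B ≤ γ + Finsupp.single u 1 + Finsupp.single v 1 := by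
      rw [add_assoc]; exact hle.trans le_self_add
    rcases neighborJoin_adj.1 huv with huv | ⟨-, ⟨hu, hv⟩ | ⟨hv, hu⟩⟩
    · refine ⟨k + 1, t, _, by ring, hB.succ huv, by gcongr, ?_, ?_⟩
      · rwa [add_tsub_add_eq_tsub_right, add_tsub_add_eq_tsub_right]
      · rwa [add_tsub_add_eq_tsub_right, add_tsub_add_eq_tsub_right]
    · refine ⟨k, t + 1, B, by ring, hB, e', ?_, ?_⟩
      · rw [e, sum_add_single, if_pos (by simpa using hu)]; omega
      · rw [e, sum_add_single, if_pos (c := v ∈ _) (by simpa using hv)]; omega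
    · refine ⟨k, t + 1, B, by ring, hB, e', ?_, ?_⟩
      · rw [e, sum_add_single, if_pos (c := v ∈ _) (by simpa using hv)]; omega
      · rw [e, sum_add_single, if_pos (by simpa using hu)]; omega

open Classical in
-- Only one new edge uv can be turned into au and bv with a single ab. The given product A of s
-- edges of G allows B to be augmented until at most one new edge is needed.
theorem IsEdgeProduct.add_edge_mem {κ : V → Bool} (hκ : ∀ u v, G.Adj u v → κ u ≠ κ v) {a b : V}
    (hab : G.Adj a b) {s : ℕ} {A ν : V →₀ ℕ} (hA : IsEdgeProduct G s A) (hAν : A ≤ ν) (t k : ℕ)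
    {B : V →₀ ℕ} (hkt : k + t = s + 1) (hB : IsEdgeProduct G k B) (hBν : B ≤ ν)
    (ha : t ≤ ∑ x with G.Adj a x, (ν - B) x) (hb : t ≤ ∑ x with G.Adj b x, (ν - B) x) :
    ν + (Finsupp.single a 1 + Finsupp.single b 1) ∈ edgePowerSet G (s + 2) := by
  induction t generalizing k B with
  | zero =>
    obtain rfl : k = s + 1 := by omega
    exact ⟨_, hB.succ hab, by rw [add_assoc]; gcongr⟩
  | succ t ih =>
    by_cases ht : t = 0
    · subst ht
      obtain rfl : k = s := by omega
      obtain ⟨u, hu, hu'⟩ := Finset.exists_ne_zero_of_sum_ne_zero (by omega :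
        ∑ x with G.Adj a x, (ν - B) x ≠ 0)
      obtain ⟨v, hv, hv'⟩ := Finset.exists_ne_zero_of_sum_ne_zero (by omega :
        ∑ x with G.Adj b x, (ν - B) x ≠ 0)
      replace hu : G.Adj a u := by simpa using hu
      replace hv : G.Adj b v := by simpa using hv
      have huv : u ≠ v := by
        rintro rfl
        have h1 := hκ _ _ hu; have h2 := hκ _ _ hv; have h3 := hκ _ _ hab
        revert h1 h2 h3; cases κ a <;> cases κ b <;> cases κ u <;> simp
      refine ⟨_, (hB.succ hu).succ hv, ?_⟩
      have h1 := (single_add_single_le huv).2 ⟨hu', hv'⟩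
      calc _ = (Finsupp.single u 1 + Finsupp.single v 1) + B +
            (Finsupp.single a 1 + Finsupp.single b 1) := by abel
        _ ≤ (ν - B) + B + (Finsupp.single a 1 + Finsupp.single b 1) := by gcongr
        _ = _ := by rw [tsub_add_cancel_of_le hBν]
    · obtain ⟨p, p', hle, hB'⟩ := hA.augment (by omega : k < s) hB
      have hle' : Finsupp.single p 1 + Finsupp.single p' 1 ≤ ν - B :=
        hle.trans (tsub_le_tsub_right hAν B)
      have e : ν - B = (ν - (B + Finsupp.single p 1 + Finsupp.single p' 1)) +
          Finsupp.single p 1 + Finsupp.single p' 1 := by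
        rw [add_assoc, add_assoc, ← tsub_tsub, tsub_add_cancel_of_le hle']
      -- Comparing colour sums before and after augmentation shows that `p` and `p'` have opposite
      -- colours. As N(x) is monochromatic, augmentation uses up at most one of its elements.
      have key : ∀ (x : V), (∑ y with G.Adj x y, (ν - B) y) ≤
          (∑ y with G.Adj x y, (ν - (B + Finsupp.single p 1 + Finsupp.single p' 1) : V →₀ ℕ) y) + 1 := by
        intro x
        rw [e, sum_add_single]
        have h1 := hB'.sum_color hκ (!(κ x))
        rw [sum_add_single, hB.sum_color hκ] at h1
        have h2 : ∀ q, q ∈ Finset.univ.filter (G.Adj x) →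
            q ∈ Finset.univ.filter (fun y => κ y = !(κ x)) := by
          intro q hq
          have := hκ x q (by simpa using hq)
          simp only [Finset.mem_filter, Finset.mem_univ, true_and]
          cases h : κ x <;> cases h' : κ q <;> simp_all
        have hp := h2 p
        have hp' := h2 p'
        split_ifs at h1 ⊢ <;> first | omega | tauto
      have h1 := key a
      have h2 := key b
      refine ih (k + 1) (by omega) hB' ?_ (by omega) (by omega)
      rw [add_assoc, ← add_tsub_cancel_of_le hBν]
      gcongr

/-- For s = 0 this identifies I^2 : ab with the edge ideal of G'; bipartiteness excludes squares, as
N(a) and N(b) are disjoint. -/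
theorem monomialColon_edgePowerSet_neighborJoin {κ : V → Bool}
    (hκ : ∀ u v, G.Adj u v → κ u ≠ κ v) {a b : V} (hab : G.Adj a b) {s : ℕ} {n : V →₀ ℕ}
    (hn : IsEdgeProduct G s n) :
    monomialColon (edgePowerSet G (s + 2)) (n + Finsupp.single a 1 + Finsupp.single b 1) =
      monomialColon (edgePowerSet (neighborJoin G a b) (s + 1)) n := by
  classical
  ext β
  rw [mem_monomialColon, mem_monomialColon, add_assoc, ← add_assoc β]
  constructor
  · rintro ⟨A, hA, hle⟩
    rcases hA.mem_or_of_le_add_edge hle with ⟨γ, hγ, h⟩ | ⟨u, v, δ, hu, hv, hδ, h⟩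
    · exact ⟨γ, hγ.mono (le_neighborJoin a b), h⟩
    · have huv : u ≠ v := by
        rintro rfl
        have h1 := hκ _ _ hu; have h2 := hκ _ _ hv; have h3 := hκ _ _ hab
        revert h1 h2 h3; cases κ a <;> cases κ b <;> cases κ u <;> simp
      exact ⟨_, (hδ.mono (le_neighborJoin a b)).succ
        (neighborJoin_adj.2 (Or.inr ⟨huv, Or.inl ⟨hu, hv⟩⟩)), h⟩
  · rintro ⟨γ, hγ, hle⟩
    obtain ⟨k, t, B, hkt, hB, hBγ, h1, h2⟩ := hγ.exists_of_neighborJoin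
    refine hn.add_edge_mem hκ hab le_add_self t k hkt hB (hBγ.trans hle)
      (h1.trans (Finset.sum_le_sum fun x _ => ?_)) (h2.trans (Finset.sum_le_sum fun x _ => ?_))
    · exact tsub_le_tsub_right hle B x
    · exact tsub_le_tsub_right hle B x

theorem MonomialRegLE.colon_edgeProduct {κ : V → Bool}
    (hκ : ∀ u v, G.Adj u v → κ u ≠ κ v) {s : ℕ} {n : V →₀ ℕ} (hn : IsEdgeProduct G s n) {r : ℤ}
    (h : MonomialRegLE K (edgePowerSet G 1) r) :
    MonomialRegLE K (monomialColon (edgePowerSet G (s + 1)) n) r := by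
  induction s generalizing G n with
  | zero => cases hn; simpa [monomialColon] using h
  | succ s ih =>
    obtain ⟨a, b, δ, hab, hδ, rfl⟩ := hn.exists_of_succ
    rw [monomialColon_edgePowerSet_neighborJoin hκ hab hδ]
    refine ih (neighborJoin_ne hκ hab) (hδ.mono (le_neighborJoin a b)) ?_
    -- The bound for I(G') needed by the induction is the bound for I^2 : ab.
    have e := monomialColon_edgePowerSet_neighborJoin hκ hab (IsEdgeProduct.zero (G := G))
    have := h.colon_edge hab
    rw [zero_add (Finsupp.single a 1)] at e
    rw [e] at this
    simpa [monomialColon] using this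

theorem MonomialRegLE.edgePowerSet_of_bipartite {κ : V → Bool}
    (hκ : ∀ u v, G.Adj u v → κ u ≠ κ v) {r : ℤ} (hr : 1 ≤ r)
    (h : MonomialRegLE K (edgePowerSet G 1) r) (s : ℕ) :
    MonomialRegLE K (edgePowerSet G (s + 1)) (r + 2 * s) := by
  induction s with
  | zero => simpa using h
  | succ s ih =>
    refine MonomialRegLE.edgePowerSet_succ hr (fun m hm => h.colon_edgeProduct hκ hm) ?_
    exact fun α i hi => ih α i (by push_cast at hi; omega)

theorem monomialRegLE_edgePowerSet_of_forall_not_adj (h : ∀ a b, ¬ G.Adj a b) (s : ℕ) (r : ℤ) :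
    MonomialRegLE K (edgePowerSet G (s + 1)) r := fun α i _ => by
  refine isAcyclicAt_of_forall_notMem ?_
  rintro τ - ⟨-, γ, hγ, -⟩
  obtain ⟨u, v, -, huv, -⟩ := hγ.exists_of_succ
  exact h u v huv

end Bipartite

/-! ### Graded free modules and multigraded strands of Koszul complexes -/

section GradedFreeModules

set_option linter.unusedSectionVars false

variable {V : Type*} [LinearOrder V] [Fintype V] {K : Type*} [Field K]

theorem mem_homogeneousPart {d : ℤ} {f : MvPolynomial V K} :
    f ∈ homogeneousPart V K d ↔ ∀ β, coeff β f ≠ 0 → (β.degree : ℤ) = d := by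
  unfold homogeneousPart
  split_ifs with h
  · rw [mem_homogeneousSubmodule]
    constructor
    · intro hf β hβ
      have : β.degree = d.toNat := by
        rw [← hf hβ, Finsupp.degree_eq_weight_one]; rfl
      omega
    · intro hf β hβ
      have := hf β hβ
      have e : Finsupp.weight 1 β = β.degree := by rw [Finsupp.degree_eq_weight_one]; rfl
      rw [e]; omega
  · rw [Submodule.mem_bot]
    constructor
    · rintro rfl β hβ; simp at hβ
    · intro hf
      ext β
      by_contra h'
      have := hf β (by simpa using h')
      omega

theorem mul_mem_homogeneousPart {d e : ℤ} {f g : MvPolynomial V K}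
    (hf : f ∈ homogeneousPart V K d) (hg : g ∈ homogeneousPart V K e) :
    f * g ∈ homogeneousPart V K (d + e) := by
  classical
  rw [mem_homogeneousPart] at *
  intro β hβ
  rw [coeff_mul] at hβ
  obtain ⟨⟨a, b⟩, hab, h⟩ := Finset.exists_ne_zero_of_sum_ne_zero hβ
  rw [Finset.HasAntidiagonal.mem_antidiagonal] at hab
  rw [← hab, map_add, Nat.cast_add, hf a (left_ne_zero_of_mul h), hg b (right_ne_zero_of_mul h)]

theorem X_mul_mem_homogeneousPart {d : ℤ} {f : MvPolynomial V K} (v : V)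
    (hf : f ∈ homogeneousPart V K (d - 1)) : X v * f ∈ homogeneousPart V K d := by
  have hX : (X v : MvPolynomial V K) ∈ homogeneousPart V K 1 := by
    classical
    rw [mem_homogeneousPart]
    intro β hβ
    rw [coeff_X] at hβ
    obtain rfl : Finsupp.single v 1 = β := by by_contra h; simp [h] at hβ
    simp
  have := mul_mem_homogeneousPart hX hf
  rwa [add_sub_cancel] at this

/-- The projection of the polynomial ring to its component of degree `d`. -/
def polynomialComponent (d : ℤ) : MvPolynomial V K →ₗ[K] MvPolynomial V K :=
  if 0 ≤ d then homogeneousComponent d.toNat else 0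

theorem coeff_polynomialComponent (d : ℤ) (f : MvPolynomial V K) (β : V →₀ ℕ) :
    coeff β (polynomialComponent d f) = if (β.degree : ℤ) = d then coeff β f else 0 := by
  unfold polynomialComponent
  split_ifs with h h' h'
  · rw [coeff_homogeneousComponent, if_pos (by omega)]
  · rw [coeff_homogeneousComponent, if_neg (by omega)]
  · omega
  · simp

variable {r s : ℕ}

theorem mem_twistedFreePart {δ : Fin r → ℤ} {j : ℤ} {v : Fin r → MvPolynomial V K} :
    v ∈ twistedFreePart δ j ↔ ∀ k, v k ∈ homogeneousPart V K (j - δ k) := by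
  simp [twistedFreePart, Submodule.mem_pi]

/-- The projection of a graded free module to its component of degree `j`. -/
def freeComponent (δ : Fin r → ℤ) (j : ℤ) :
    (Fin r → MvPolynomial V K) →ₗ[K] (Fin r → MvPolynomial V K) :=
  LinearMap.pi fun k => polynomialComponent (j - δ k) ∘ₗ LinearMap.proj k

theorem freeComponent_apply (δ : Fin r → ℤ) (j : ℤ) (v : Fin r → MvPolynomial V K) (k : Fin r) :
    freeComponent δ j v k = polynomialComponent (j - δ k) (v k) := rfl

theorem freeComponent_mem (δ : Fin r → ℤ) (j : ℤ) (v : Fin r → MvPolynomial V K) :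
    freeComponent δ j v ∈ twistedFreePart δ j := by
  rw [mem_twistedFreePart]
  intro k
  rw [mem_homogeneousPart]
  intro β hβ
  rw [freeComponent_apply, coeff_polynomialComponent] at hβ
  by_contra h
  simp [h] at hβ

theorem freeComponent_of_mem {δ : Fin r → ℤ} {j : ℤ} (j' : ℤ) {v : Fin r → MvPolynomial V K}
    (h : v ∈ twistedFreePart δ j) : freeComponent δ j' v = if j' = j then v else 0 := by
  rw [mem_twistedFreePart] at h
  ext k β
  have hk := mem_homogeneousPart.1 (h k) β
  rw [freeComponent_apply, coeff_polynomialComponent]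
  by_cases h0 : coeff β (v k) = 0
  · split_ifs <;> simp [h0]
  · have := hk h0
    by_cases hj : j' = j
    · subst hj; simp [this]
    · rw [if_neg (by omega), if_neg hj]; simp

theorem exists_sum_freeComponent (δ : Fin r → ℤ) (v : Fin r → MvPolynomial V K) :
    ∃ s : Finset ℤ, ∀ t, s ⊆ t → ∑ j ∈ t, freeComponent δ j v = v := by
  classical
  refine ⟨Finset.univ.biUnion fun k => (v k).support.image fun β => (β.degree : ℤ) + δ k,
    fun t ht => ?_⟩
  ext k β
  rw [Finset.sum_apply, coeff_sum]
  simp only [freeComponent_apply, coeff_polynomialComponent]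
  by_cases h0 : coeff β (v k) = 0
  · simp [h0]
  · have hmem : (β.degree : ℤ) + δ k ∈ t := ht (by
      simp only [Finset.mem_biUnion, Finset.mem_univ, true_and, Finset.mem_image]
      exact ⟨k, β, mem_support_iff.2 h0, rfl⟩)
    rw [Finset.sum_eq_single_of_mem _ hmem, if_pos (by ring)]
    intro j _ hj
    rw [if_neg]
    intro h; exact hj (by rw [h]; ring)

/-- A homomorphism of graded free modules, homogeneous of degree zero. -/
def IsGradedHom (δ : Fin r → ℤ) (ε : Fin s → ℤ)
    (φ : (Fin r → MvPolynomial V K) →ₗ[MvPolynomial V K] (Fin s → MvPolynomial V K)) : Prop :=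
  ∀ (j : ℤ), ∀ v ∈ twistedFreePart δ j, φ v ∈ twistedFreePart (K := K) ε j

variable {δ : Fin r → ℤ} {ε : Fin s → ℤ}
  {φ : (Fin r → MvPolynomial V K) →ₗ[MvPolynomial V K] (Fin s → MvPolynomial V K)}

theorem IsGradedHom.map_freeComponent (h : IsGradedHom δ ε φ) (j : ℤ)
    (v : Fin r → MvPolynomial V K) : φ (freeComponent δ j v) = freeComponent ε j (φ v) := by
  classical
  obtain ⟨t, ht⟩ := exists_sum_freeComponent δ v
  conv_rhs => rw [← ht (insert j t) (Finset.subset_insert j t), map_sum, map_sum]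
  rw [Finset.sum_eq_single_of_mem j (Finset.mem_insert_self j t),
    freeComponent_of_mem j (h j _ (freeComponent_mem δ j v)), if_pos rfl]
  intro j' _ hj'
  rw [freeComponent_of_mem j (h j' _ (freeComponent_mem δ j' v)), if_neg hj'.symm]

theorem IsGradedHom.exists_lift (h : IsGradedHom δ ε φ) {j : ℤ} {w : Fin s → MvPolynomial V K}
    (hw : w ∈ LinearMap.range φ) (hwj : w ∈ twistedFreePart ε j) :
    ∃ v ∈ twistedFreePart δ j, φ v = w := by
  obtain ⟨v, rfl⟩ := hw
  exact ⟨_, freeComponent_mem δ j v, by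
    rw [h.map_freeComponent, freeComponent_of_mem j hwj, if_pos rfl]⟩

theorem mem_irrelevantIdeal_iff {f : MvPolynomial V K} :
    f ∈ irrelevantIdeal V K ↔ constantCoeff f = 0 := by
  rw [irrelevantIdeal, ← Set.image_univ, mem_ideal_span_X_image, constantCoeff_eq]
  constructor
  · intro h
    by_contra h'
    obtain ⟨i, -, hi⟩ := h 0 (mem_support_iff.2 h')
    simp at hi
  · intro h m hm
    by_contra! h'
    have : m = 0 := by ext i; exact h' i trivial
    subst this
    exact mem_support_iff.1 hm h

theorem mem_irrelevantIdeal_smul_top_iff {v : Fin r → MvPolynomial V K} :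
    v ∈ irrelevantIdeal V K • (⊤ : Submodule (MvPolynomial V K) (Fin r → MvPolynomial V K)) ↔
      ∀ k, constantCoeff (v k) = 0 := by
  constructor
  · intro h k
    induction h using Submodule.smul_induction_on' with
    | smul a ha n _ => simp [mem_irrelevantIdeal_iff.1 ha]
    | add x _ y _ hx hy => simp [hx, hy]
  · intro h
    rw [pi_eq_sum_univ' v]
    refine Submodule.sum_mem _ fun k _ => ?_
    exact Submodule.smul_mem_smul (mem_irrelevantIdeal_iff.2 (h k)) trivial

theorem X_smul_mem_twistedFreePart {j : ℤ} {w : Fin r → MvPolynomial V K} (x : V)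
    (hw : w ∈ twistedFreePart δ (j - 1)) :
    (X x : MvPolynomial V K) • w ∈ twistedFreePart δ j := by
  rw [mem_twistedFreePart] at *
  intro k
  refine X_mul_mem_homogeneousPart x ?_
  convert hw k using 1; ring_nf

variable (δ) in
/-- A homogeneous chain of degree `j` in homological degree `p` of the Koszul complex with
coefficients in a submodule `N` of a graded free module. -/
def IsKoszulChain (N : Submodule (MvPolynomial V K) (Fin r → MvPolynomial V K)) (p : ℕ) (j : ℤ)
    (c : Finset V → Fin r → MvPolynomial V K) : Prop :=
  ∀ τ, c τ ∈ N ∧ c τ ∈ twistedFreePart δ (j - τ.card) ∧ (τ.card ≠ p → c τ = 0)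

variable {N : Submodule (MvPolynomial V K) (Fin r → MvPolynomial V K)} {p : ℕ} {j : ℤ}
  {c : Finset V → Fin r → MvPolynomial V K}

theorem IsKoszulChain.sub {c' : Finset V → Fin r → MvPolynomial V K} (h : IsKoszulChain δ N p j c)
    (h' : IsKoszulChain δ N p j c') : IsKoszulChain δ N p j (c - c') := fun τ =>
  ⟨N.sub_mem (h τ).1 (h' τ).1, Submodule.sub_mem _ (h τ).2.1 (h' τ).2.1, fun hτ => by
    simp [(h τ).2.2 hτ, (h' τ).2.2 hτ]⟩

theorem IsKoszulChain.mono {N' : Submodule (MvPolynomial V K) (Fin r → MvPolynomial V K)}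
    (h : IsKoszulChain δ N p j c) (hN : N ≤ N') : IsKoszulChain δ N' p j c := fun τ =>
  ⟨hN (h τ).1, (h τ).2⟩

variable (V K) in
/-- The Koszul differential of the variables. -/
abbrev koszulX (r : ℕ) : (Finset V → Fin r → MvPolynomial V K) →ₗ[MvPolynomial V K]
    (Finset V → Fin r → MvPolynomial V K) := koszul X

theorem IsKoszulChain.koszul (h : IsKoszulChain δ N (p + 1) j c) :
    IsKoszulChain δ N p j (koszulX V K r c) := by
  intro τ
  have key : ∀ v, (X v : MvPolynomial V K) • contract (MvPolynomial V K) v c τ ∈ N ∧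
      (X v : MvPolynomial V K) • contract (MvPolynomial V K) v c τ ∈ twistedFreePart δ (j - τ.card) ∧
      (τ.card ≠ p → contract (MvPolynomial V K) v c τ = 0) := by
    intro v
    rw [contract_apply]
    split_ifs with hv
    · simp
    · have h1 := h (insert v τ)
      rw [Finset.card_insert_of_notMem hv] at h1
      refine ⟨N.smul_mem _ (zsmul_mem h1.1 _), X_smul_mem_twistedFreePart v ?_, fun hτ => ?_⟩
      · refine zsmul_mem ?_ _
        convert h1.2.1 using 1; push_cast; ring_nf
      · rw [h1.2.2 (by omega), smul_zero]
  rw [koszul_apply]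
  refine ⟨N.sum_mem fun v _ => (key v).1, Submodule.sum_mem _ fun v _ => (key v).2.1, fun hτ => ?_⟩
  exact Finset.sum_eq_zero fun v _ => by rw [(key v).2.2 hτ, smul_zero]

theorem IsKoszulChain.koszul_zero (h : IsKoszulChain δ N 0 j c) : koszulX V K r c = 0 := by
  ext1 τ
  rw [koszul_apply]
  refine Finset.sum_eq_zero fun v _ => ?_
  rw [contract_apply, (h (insert v τ)).2.2 (by
    rw [← Nat.pos_iff_ne_zero]; exact Finset.card_pos.2 (Finset.insert_nonempty v τ))]
  simp

variable (δ N p j) in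
/-- The vanishing of Koszul homology in homological degree `p` and internal degree `j`. -/
def IsKoszulAcyclicAt : Prop :=
  ∀ c, IsKoszulChain δ N p j c → koszulX V K r c = 0 →
    ∃ b, IsKoszulChain δ N (p + 1) j b ∧ koszulX V K r b = c

theorem IsGradedHom.exists_chain_lift (h : IsGradedHom δ ε φ)
    {c : Finset V → Fin s → MvPolynomial V K} (hc : IsKoszulChain ε (LinearMap.range φ) p j c) :
    ∃ b, IsKoszulChain δ ⊤ p j b ∧ (fun τ => φ (b τ)) = c := by
  have : ∀ τ, ∃ v, v ∈ twistedFreePart δ (j - τ.card) ∧ φ v = c τ ∧ (τ.card ≠ p → v = 0) := by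
    intro τ
    by_cases hτ : τ.card = p
    · obtain ⟨v, hv, e⟩ := h.exists_lift (hc τ).1 (hc τ).2.1
      exact ⟨v, hv, e, fun h => absurd hτ h⟩
    · exact ⟨0, Submodule.zero_mem _, by rw [map_zero, (hc τ).2.2 hτ], fun _ => rfl⟩
  choose b hb using this
  exact ⟨b, fun τ => ⟨trivial, (hb τ).1, (hb τ).2.2⟩, funext fun τ => (hb τ).2.1⟩

theorem IsGradedHom.map_chain (h : IsGradedHom δ ε φ) (hc : IsKoszulChain δ ⊤ p j c) :
    IsKoszulChain ε (LinearMap.range φ) p j (fun τ => φ (c τ)) := fun τ =>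
  ⟨⟨_, rfl⟩, h _ _ (hc τ).2.1, fun hτ => by simp only [(hc τ).2.2 hτ, map_zero]⟩

/-- The scalar chain of multidegree `α` of a Koszul chain. -/
def multidegreePart (α : V →₀ ℕ) (c : Finset V → MvPolynomial V K) : Finset V → K := fun τ =>
  open Classical in if faceExponent τ ≤ α then coeff (α - faceExponent τ) (c τ) else 0

theorem multidegreePart_add_faceExponent (β : V →₀ ℕ) (c : Finset V → MvPolynomial V K)
    (τ : Finset V) : multidegreePart (β + faceExponent τ) c τ = coeff β (c τ) := by
  simp [multidegreePart]

/-- In a fixed multidegree the monomial at a face is determined by the face, so multiplication by `X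
v` leaves the scalar unchanged and only the simplicial boundary remains. -/
theorem boundary_multidegreePart (α : V →₀ ℕ) (c : Finset V → MvPolynomial V K) :
    boundary K (multidegreePart α c) =
      multidegreePart α (koszul (X : V → MvPolynomial V K) c) := by
  classical
  ext τ
  rw [koszul_apply, multidegreePart]
  simp only [koszul_apply, coeff_sum]
  have key : ∀ v, contract K v (multidegreePart α c) τ =
      if faceExponent τ ≤ α then
        coeff (α - faceExponent τ) ((X v : MvPolynomial V K) • contract (MvPolynomial V K) v c τ) else 0 := by
    intro v
    rw [contract_apply, contract_apply]
    by_cases hv : v ∈ τ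
    · simp [hv]
    rw [if_neg hv, if_neg hv, multidegreePart, faceExponent_insert hv]
    have hz : ∀ (n : ℤ) (f : MvPolynomial V K) (m : V →₀ ℕ), coeff m (n • f) = n • coeff m f :=
      fun n f m => map_zsmul (lcoeff K m) n f
    by_cases h : faceExponent τ + Finsupp.single v 1 ≤ α
    · have h1 : faceExponent τ ≤ α := le_self_add.trans h
      have h2 : α - faceExponent τ =
          Finsupp.single v 1 + (α - (faceExponent τ + Finsupp.single v 1)) := by
        rw [← tsub_tsub, add_tsub_cancel_of_le]
        exact le_tsub_of_add_le_left h
      rw [if_pos h, if_pos h1, smul_eq_mul, h2, coeff_X_mul, hz]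
    · rw [if_neg h, smul_zero]
      split_ifs with h1
      · rw [smul_eq_mul, coeff_X_mul', if_neg]
        intro hmem
        refine h (fun w => ?_)
        have h3 := h1 w
        rw [Finsupp.mem_support_iff, Finsupp.tsub_apply] at hmem
        simp only [Finsupp.add_apply, Finsupp.single_apply]
        split_ifs with hw
        · subst hw; omega
        · simpa using h3
      · rfl
  simp only [Pi.one_apply, one_smul, key]
  split_ifs <;> simp

theorem eq_of_multidegreePart_eq {c c' : Finset V → MvPolynomial V K}
    (h : ∀ α, multidegreePart α c = multidegreePart α c') : c = c' := by
  ext τ β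
  rw [← multidegreePart_add_faceExponent, h, multidegreePart_add_faceExponent]

/-- There are finitely many multidegrees of total degree `j`, so fillings chosen in each of them
assemble into polynomial coefficients. -/
theorem exists_koszul_of_boundary (S : Set (V →₀ ℕ)) {p : ℕ} {j : ℤ}
    {c : Finset V → MvPolynomial V K}
    (hc : ∀ τ, c τ ∈ homogeneousPart V K (j - τ.card))
    (h : ∀ α : V →₀ ℕ, (α.degree : ℤ) = j → ∃ g, IsChainOf (degreeComplex S α) (p + 1) g ∧
      boundary K g = multidegreePart α c) :
    ∃ b : Finset V → MvPolynomial V K, (∀ τ, b τ ∈ homogeneousPart V K (j - τ.card) ∧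
      (τ.card ≠ p + 1 → b τ = 0) ∧ ∀ β, coeff β (b τ) ≠ 0 → β ∈ S) ∧
      koszul (X : V → MvPolynomial V K) b = c := by
  classical
  choose! g hg hg' using h
  have hfin : ∀ n : ℤ, {β : V →₀ ℕ | (β.degree : ℤ) = n}.Finite := by
    intro n
    refine (Set.finite_Iic (Finsupp.equivFunOnFinite.symm fun _ : V => n.toNat)).subset ?_
    intro γ hγ v
    have h1 : γ v ≤ γ.degree := by
      rw [degree_eq_sum_univ]
      exact Finset.single_le_sum (f := fun v => γ v) (fun _ _ => Nat.zero_le _)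
        (Finset.mem_univ v)
    have h2 : (γ.degree : ℤ) = n := hγ
    change γ v ≤ n.toNat
    omega
  set b : Finset V → MvPolynomial V K := fun τ =>
    ∑ β ∈ (hfin (j - τ.card)).toFinset, monomial β (g (β + faceExponent τ) τ) with hb
  have hcoeff : ∀ τ β, coeff β (b τ) =
      if (β.degree : ℤ) = j - τ.card then g (β + faceExponent τ) τ else 0 := by
    intro τ β
    rw [hb]
    simp only [coeff_sum, coeff_monomial]
    rw [Finset.sum_ite_eq']
    simp
  have hdeg : ∀ (β : V →₀ ℕ) (τ : Finset V), (β.degree : ℤ) = j - τ.card →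
      ((β + faceExponent τ).degree : ℤ) = j := by
    intro β τ h
    rw [map_add, degree_faceExponent]; push_cast; omega
  refine ⟨b, fun τ => ⟨?_, fun hτ => ?_, fun β hβ => ?_⟩, eq_of_multidegreePart_eq fun α => ?_⟩
  · rw [mem_homogeneousPart]
    intro β hβ
    rw [hcoeff] at hβ
    by_contra h'
    simp [h'] at hβ
  · ext β
    rw [hcoeff]
    split_ifs with h1
    · by_contra h'
      exact hτ (hg _ (hdeg β τ h1) τ (by simpa using h')).2
    · simp
  · rw [hcoeff] at hβ
    by_cases h1 : (β.degree : ℤ) = j - τ.card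
    · rw [if_pos h1] at hβ
      have := (hg _ (hdeg β τ h1) τ hβ).1.2
      simpa using this
    · simp [h1] at hβ
  · rw [← boundary_multidegreePart]
    by_cases hα : (α.degree : ℤ) = j
    · rw [← hg' α hα]
      congr 1
      ext τ
      rw [multidegreePart]
      split_ifs with hle
      · rw [hcoeff, if_pos (by rw [degree_tsub_of_le hle, degree_faceExponent]; omega),
          tsub_add_cancel_of_le hle]
      · by_contra h'
        exact hle (hg α hα τ (Ne.symm h')).1.1
    · have h0 : ∀ c' : Finset V → MvPolynomial V K,
          (∀ τ, c' τ ∈ homogeneousPart V K (j - τ.card)) → multidegreePart α c' = 0 := by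
        intro c' hc'
        ext τ
        rw [multidegreePart]
        split_ifs with hle
        · by_contra h'
          have := mem_homogeneousPart.1 (hc' τ) _ h'
          rw [degree_tsub_of_le hle, degree_faceExponent] at this
          omega
        · rfl
      rw [h0 c hc, h0 b, map_zero]
      intro τ
      rw [mem_homogeneousPart]
      intro β hβ
      rw [hcoeff] at hβ
      by_contra h'
      simp [h'] at hβ

end GradedFreeModules

/-! ### Koszul homology: free modules, dimension shifting, monomial ideals -/

section KoszulAcyclicity

set_option linter.unusedSectionVars false

variable {V : Type*} [LinearOrder V] [Fintype V] {K : Type*} [Field K] {r s : ℕ}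
  {δ : Fin r → ℤ} {ε : Fin s → ℤ}
  {φ : (Fin r → MvPolynomial V K) →ₗ[MvPolynomial V K] (Fin s → MvPolynomial V K)}
  {N : Submodule (MvPolynomial V K) (Fin r → MvPolynomial V K)} {p : ℕ} {j : ℤ}
  {c : Finset V → Fin r → MvPolynomial V K}

theorem koszulX_apply_coordinate (c : Finset V → Fin r → MvPolynomial V K) (k : Fin r) :
    koszul (X : V → MvPolynomial V K) (fun τ => c τ k) = fun τ => koszulX V K r c τ k :=
  koszul_map X (LinearMap.proj k : (Fin r → MvPolynomial V K) →ₗ[MvPolynomial V K] _) c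

theorem isChainOf_multidegreePart {S : Set (V →₀ ℕ)} {c : Finset V → MvPolynomial V K} {p : ℕ}
    (hp : ∀ τ, τ.card ≠ p → c τ = 0) (hS : ∀ τ β, coeff β (c τ) ≠ 0 → β ∈ S) (α : V →₀ ℕ) :
    IsChainOf (degreeComplex S α) p (multidegreePart α c) := by
  intro τ hτ
  rw [multidegreePart] at hτ
  by_cases hle : faceExponent τ ≤ α
  · rw [if_pos hle] at hτ
    refine ⟨⟨hle, hS τ _ hτ⟩, ?_⟩
    by_contra h
    rw [hp τ h] at hτ
    simp at hτ
  · simp [hle] at hτ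

theorem multidegreePart_zero (α : V →₀ ℕ) :
    multidegreePart α (0 : Finset V → MvPolynomial V K) = 0 := by
  ext τ; simp [multidegreePart]

/-- The Koszul complex of a free module has homology only in degree 0, given by constant
coefficients. In a nonzero multidegree the complex is a cone; in multidegree 0 only the empty face
is left. -/
theorem exists_koszul_eq_of_constantCoeff (hc : IsKoszulChain δ ⊤ p j c)
    (hc0 : koszulX V K r c = 0) (h : ∀ k, constantCoeff (c ∅ k) = 0) :
    ∃ b, IsKoszulChain δ ⊤ (p + 1) j b ∧ koszulX V K r b = c := by
  have key : ∀ k, ∃ b : Finset V → MvPolynomial V K,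
      (∀ τ, b τ ∈ homogeneousPart V K (j - δ k - τ.card) ∧
      (τ.card ≠ p + 1 → b τ = 0) ∧ ∀ β, coeff β (b τ) ≠ 0 → β ∈ Set.univ) ∧
      koszul (X : V → MvPolynomial V K) b = fun τ => c τ k := by
    intro k
    refine exists_koszul_of_boundary Set.univ (fun τ => ?_) fun α hα => ?_
    · convert mem_twistedFreePart.1 (hc τ).2.1 k using 1; ring_nf
    · have h1 : IsChainOf (degreeComplex Set.univ α) p (multidegreePart α fun τ => c τ k) :=
        isChainOf_multidegreePart (fun τ hτ => by rw [(hc τ).2.2 hτ]; rfl)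
          (fun _ _ _ => trivial) α
      have h2 : boundary K (multidegreePart α fun τ => c τ k) = 0 := by
        rw [boundary_multidegreePart, koszulX_apply_coordinate, hc0]
        exact multidegreePart_zero α
      by_cases h0 : α = 0
      · refine ⟨0, fun τ hτ => absurd rfl hτ, ?_⟩
        rw [map_zero]
        ext τ
        by_contra h'
        have h3 := (h1 τ (Ne.symm h')).1.1
        have h4 : τ = ∅ := by
          rw [Finset.eq_empty_iff_forall_notMem]
          intro v hv
          have := h3 v
          simp [faceExponent_apply, hv, h0] at this
        subst h4
        apply h'
        have := h k
        rw [constantCoeff_eq] at this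
        simp [multidegreePart, faceExponent_empty, h0, this]
      · obtain ⟨v, hv⟩ : ∃ v, α v ≠ 0 := by
          by_contra! h'; exact h0 (Finsupp.ext h')
        refine isAcyclicAt_of_cone (Δ := degreeComplex Set.univ α) v
          (fun τ hτ => ⟨fun w => ?_, trivial⟩) p _ h1 h2
        have := hτ.1 w
        simp only [faceExponent_apply, Finset.mem_insert] at this ⊢
        by_cases hw : w = v
        · subst hw; simp; omega
        · simpa [hw] using this
  choose b hb hb' using key
  refine ⟨fun τ k => b k τ, fun τ => ⟨trivial, mem_twistedFreePart.2 fun k => ?_, fun hτ => ?_⟩, ?_⟩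
  · convert (hb k τ).1 using 1; ring_nf
  · ext1 k; exact (hb k τ).2.1 hτ
  · ext1 τ; ext1 k
    have := congr_fun (koszulX_apply_coordinate (fun τ k => b k τ) k) τ
    rw [← this]
    exact congr_fun (hb' k) τ

theorem IsGradedHom.koszul_comp (c : Finset V → Fin r → MvPolynomial V K) :
    koszulX V K s (fun τ => φ (c τ)) = fun τ => φ (koszulX V K r c τ) := koszul_map X φ c

theorem IsKoszulChain.of_comp_eq_zero (hc : IsKoszulChain δ ⊤ p j c)
    (h : (fun τ => φ (c τ)) = 0) : IsKoszulChain δ (LinearMap.ker φ) p j c := fun τ =>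
  ⟨congr_fun h τ, (hc τ).2⟩

/-- Dimension shifting along a minimal graded presentation. -/
theorem IsGradedHom.isKoszulAcyclicAt_range_succ_iff (h : IsGradedHom δ ε φ)
    (hmin : LinearMap.ker φ ≤ irrelevantIdeal V K • ⊤) :
    IsKoszulAcyclicAt ε (LinearMap.range φ) (p + 1) j ↔
      IsKoszulAcyclicAt δ (LinearMap.ker φ) p j := by
  constructor
  · intro hr a ha ha0
    -- Minimality enters here, for `p = 0`: it makes the kernel vanish in the degree 0 homology of
    -- the free module.
    obtain ⟨b, hb, rfl⟩ := exists_koszul_eq_of_constantCoeff (ha.mono le_top) ha0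
      (mem_irrelevantIdeal_smul_top_iff.1 (hmin (ha ∅).1))
    obtain ⟨c', hc', e⟩ := hr _ (h.map_chain hb) (by
      rw [IsGradedHom.koszul_comp]
      ext1 τ; exact (ha τ).1)
    obtain ⟨b', hb', rfl⟩ := h.exists_chain_lift hc'
    refine ⟨b - koszulX V K r b', (hb.sub hb'.koszul).of_comp_eq_zero ?_, ?_⟩
    · rw [IsGradedHom.koszul_comp] at e
      ext1 τ
      have := congr_fun e τ
      simp only [Pi.sub_apply, map_sub] at this ⊢
      rw [this, sub_self]; rfl
    · rw [map_sub, koszul_koszul, sub_zero]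
  · intro hk c hc hc0
    obtain ⟨b, hb, rfl⟩ := h.exists_chain_lift hc
    rw [IsGradedHom.koszul_comp] at hc0
    obtain ⟨a', ha', e⟩ := hk _ (hb.koszul.of_comp_eq_zero hc0) (koszul_koszul _ _)
    obtain ⟨b', hb', e'⟩ := exists_koszul_eq_of_constantCoeff (hb.sub (ha'.mono le_top))
      (by rw [map_sub, e, sub_self]) (by
        intro k
        rw [((hb.sub (ha'.mono le_top)) ∅).2.2 (by simp)]; simp)
    refine ⟨_, h.map_chain hb', ?_⟩
    rw [IsGradedHom.koszul_comp, e']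
    ext1 τ
    have : φ (a' τ) = 0 := (ha' τ).1
    simp [this]

/-- Degree 0 Koszul homology is the module modulo the irrelevant ideal, and by minimality the basis
of the cover maps to a basis of it. -/
theorem IsGradedHom.isKoszulAcyclicAt_range_zero_iff (h : IsGradedHom δ ε φ)
    (hmin : LinearMap.ker φ ≤ irrelevantIdeal V K • ⊤) :
    IsKoszulAcyclicAt ε (LinearMap.range φ) 0 j ↔ ∀ k, δ k ≠ j := by
  classical
  constructor
  · rintro hr k rfl
    have h1 : (Pi.single k 1 : Fin r → MvPolynomial V K) ∈ twistedFreePart δ (δ k) := by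
      rw [mem_twistedFreePart]
      intro l
      by_cases hl : l = k
      · subst hl
        rw [mem_homogeneousPart]
        intro β hβ
        rw [Pi.single_eq_same, coeff_one] at hβ
        obtain rfl : 0 = β := by by_contra h'; simp [h'] at hβ
        simp
      · rw [Pi.single_eq_of_ne hl]; exact Submodule.zero_mem _
    have hc : IsKoszulChain ε (LinearMap.range φ) 0 (δ k)
        (Pi.single ∅ (φ (Pi.single k 1))) := by
      intro τ
      by_cases hτ : τ = ∅
      · subst hτ
        rw [Pi.single_eq_same]
        exact ⟨⟨_, rfl⟩, by simpa using h _ _ h1, fun h => absurd rfl h⟩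
      · rw [Pi.single_eq_of_ne hτ]
        exact ⟨Submodule.zero_mem _, Submodule.zero_mem _, fun _ => rfl⟩
    obtain ⟨b, hb, e⟩ := hr _ hc hc.koszul_zero
    obtain ⟨b', hb', rfl⟩ := h.exists_chain_lift hb
    rw [IsGradedHom.koszul_comp] at e
    have e1 := congr_fun e ∅
    rw [Pi.single_eq_same, ← sub_eq_zero, ← map_sub] at e1
    have e2 := mem_irrelevantIdeal_smul_top_iff.1 (hmin e1) k
    rw [Pi.sub_apply, map_sub, Pi.single_eq_same, map_one, koszul_apply, Finset.sum_apply,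
      map_sum, Finset.sum_eq_zero] at e2
    · simp at e2
    · intro v _
      simp
  · intro hk c hc _
    obtain ⟨b, hb, rfl⟩ := h.exists_chain_lift hc
    obtain ⟨b', hb', e⟩ := exists_koszul_eq_of_constantCoeff hb hb.koszul_zero (by
      intro k
      by_contra h'
      rw [constantCoeff_eq] at h'
      have := mem_homogeneousPart.1 (mem_twistedFreePart.1 (hb ∅).2.1 k) 0 h'
      refine hk k ?_
      simp at this; omega)
    exact ⟨_, h.map_chain hb', by rw [IsGradedHom.koszul_comp, e]⟩

/-- An ideal as a submodule of the free module of rank one. -/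
def idealSubmodule (I : Ideal (MvPolynomial V K)) :
    Submodule (MvPolynomial V K) (Fin 1 → MvPolynomial V K) := Submodule.pi Set.univ fun _ => I

theorem mem_idealSubmodule {I : Ideal (MvPolynomial V K)} {v : Fin 1 → MvPolynomial V K} :
    v ∈ idealSubmodule I ↔ v 0 ∈ I := by
  simp [idealSubmodule, Submodule.mem_pi, Fin.forall_fin_one]

/-- The Koszul complex of a monomial ideal splits by multidegree, and its strand in multidegree `α`
is the chain complex of `degreeComplex S α`. -/
theorem isKoszulAcyclicAt_idealSubmodule_iff {I : Ideal (MvPolynomial V K)} {S : Set (V →₀ ℕ)}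
    (hI : ∀ f, f ∈ I ↔ ∀ β, coeff β f ≠ 0 → β ∈ S) :
    IsKoszulAcyclicAt (fun _ : Fin 1 => 0) (idealSubmodule I) p j ↔
      ∀ α : V →₀ ℕ, (α.degree : ℤ) = j → IsAcyclicAt K (degreeComplex S α) p := by
  classical
  constructor
  · intro hI' α hα f hf hf0
    set c : Finset V → MvPolynomial V K := fun τ => monomial (α - faceExponent τ) (f τ) with hc
    have hcoeff : ∀ τ β, coeff β (c τ) ≠ 0 → β = α - faceExponent τ ∧ f τ ≠ 0 := by
      intro τ β hβ
      rw [hc] at hβ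
      simp only [coeff_monomial] at hβ
      by_cases h : α - faceExponent τ = β
      · exact ⟨h.symm, by simpa [h] using hβ⟩
      · simp [h] at hβ
    have hα' : multidegreePart α c = f := by
      ext τ
      rw [multidegreePart]
      split_ifs with hle
      · simp [hc]
      · by_contra h'
        exact hle (hf τ (Ne.symm h')).1.1
    have hk : koszul (X : V → MvPolynomial V K) c = 0 := by
      refine eq_of_multidegreePart_eq fun α' => ?_
      rw [← boundary_multidegreePart, multidegreePart_zero]
      by_cases h : α' = α
      · rw [h, hα', hf0]
      · have : multidegreePart α' c = 0 := by
          ext τ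
          rw [multidegreePart]
          split_ifs with hle
          · by_contra h'
            obtain ⟨h1, h2⟩ := hcoeff τ _ h'
            refine h ?_
            rw [← tsub_add_cancel_of_le hle, h1, tsub_add_cancel_of_le (hf τ h2).1.1]
          · rfl
        rw [this, map_zero]
    have hchain : IsKoszulChain (fun _ : Fin 1 => 0) (idealSubmodule I) p j
        (fun τ _ => c τ) := by
      refine fun τ => ⟨?_, ?_, fun hτ => ?_⟩
      · rw [mem_idealSubmodule, hI]
        intro β hβ
        obtain ⟨rfl, h2⟩ := hcoeff τ β hβ
        exact (hf τ h2).1.2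
      · rw [mem_twistedFreePart]
        intro _
        rw [mem_homogeneousPart]
        intro β hβ
        obtain ⟨rfl, h2⟩ := hcoeff τ β hβ
        rw [degree_tsub_of_le (hf τ h2).1.1, degree_faceExponent, hα, sub_zero]
      · ext1 _
        by_contra h'
        have : f τ ≠ 0 := fun h0 => h' (by simp [hc, h0])
        exact hτ (hf τ this).2
    have hcycle : koszulX V K 1 (fun τ _ => c τ) = 0 := by
      ext1 τ; ext1 k
      have := congr_fun (koszulX_apply_coordinate (fun τ (_ : Fin 1) => c τ) k) τ
      rw [← this, hk]; rfl
    obtain ⟨b, hb, e⟩ := hI' _ hchain hcycle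
    refine ⟨multidegreePart α fun τ => b τ 0, isChainOf_multidegreePart
      (fun τ hτ => by rw [(hb τ).2.2 hτ]; rfl)
      (fun τ => (hI _).1 (mem_idealSubmodule.1 (hb τ).1)) α, ?_⟩
    rw [boundary_multidegreePart, koszulX_apply_coordinate, e, hα']
  · intro hS c hc hc0
    obtain ⟨b, hb, e⟩ := exists_koszul_of_boundary S (p := p) (j := j) (c := fun τ => c τ 0)
      (fun τ => by simpa using mem_twistedFreePart.1 (hc τ).2.1 0) (fun α hα => by
        refine hS α hα _ (isChainOf_multidegreePart (fun τ hτ => by rw [(hc τ).2.2 hτ]; rfl)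
          (fun τ => (hI _).1 (mem_idealSubmodule.1 (hc τ).1)) α) ?_
        rw [boundary_multidegreePart, koszulX_apply_coordinate, hc0]
        exact multidegreePart_zero α)
    refine ⟨fun τ _ => b τ, fun τ => ⟨mem_idealSubmodule.2 ((hI _).2 (hb τ).2.2),
      mem_twistedFreePart.2 fun _ => by simpa using (hb τ).1, fun hτ => ?_⟩, ?_⟩
    · ext1 _; exact (hb τ).2.1 hτ
    · ext1 τ; ext1 k
      have := congr_fun (koszulX_apply_coordinate (fun τ (_ : Fin 1) => b τ) k) τ
      rw [← this, e, Fin.fin_one_eq_zero k]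

end KoszulAcyclicity

/-! ### Betti numbers of a minimal resolution via Koszul homology -/

section Resolutions

set_option linter.unusedSectionVars false

variable {V : Type*} [LinearOrder V] [Fintype V] {K : Type*} [Field K]
  {I : Ideal (MvPolynomial V K)}

/-- The augmentation of a resolution of an ideal, as a map to the free module of rank one. -/
def MinimalGradedFreeResolution.augmentationToFree
    (F : MinimalGradedFreeResolution (σ := V) (idealPart I)) :
    (Fin (F.rank 0) → MvPolynomial V K) →ₗ[MvPolynomial V K] (Fin 1 → MvPolynomial V K) :=
  LinearMap.pi fun _ => (Submodule.subtype I) ∘ₗ F.augmentation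

theorem MinimalGradedFreeResolution.isKoszulAcyclicAt_range_differential
    (F : MinimalGradedFreeResolution (σ := V) (idealPart I)) (p i : ℕ) (j : ℤ) :
    IsKoszulAcyclicAt (F.shift i) (LinearMap.range (F.differential i)) p j ↔
      ∀ k, F.shift (i + 1 + p) k ≠ j := by
  have hgr : ∀ i, IsGradedHom (F.shift (i + 1)) (F.shift i) (F.differential i) :=
    F.differential_mem
  have hker : ∀ i, LinearMap.ker (F.differential i) = LinearMap.range (F.differential (i + 1)) :=
    fun i => LinearMap.exact_iff.1 (F.exact_succ i)
  have hmin : ∀ i, LinearMap.ker (F.differential i) ≤ irrelevantIdeal V K • ⊤ := fun i => by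
    rw [hker]; exact F.minimal (i + 1)
  induction p generalizing i with
  | zero => exact (hgr i).isKoszulAcyclicAt_range_zero_iff (hmin i)
  | succ p ih =>
    have := ih (i + 1)
    rw [show i + 1 + 1 + p = i + 1 + (p + 1) by omega] at this
    rw [(hgr i).isKoszulAcyclicAt_range_succ_iff (hmin i), hker]
    exact this

/-- The shifts that occur in homological degree p are the degrees where the p-th Koszul homology is
nonzero; in particular they do not depend on the resolution. -/
theorem MinimalGradedFreeResolution.isKoszulAcyclicAt_iff
    (F : MinimalGradedFreeResolution (σ := V) (idealPart I)) (p : ℕ) (j : ℤ) :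
    IsKoszulAcyclicAt (fun _ : Fin 1 => 0) (idealSubmodule I) p j ↔ ∀ k, F.shift p k ≠ j := by
  have hgr : IsGradedHom (F.shift 0) (fun _ => 0) F.augmentationToFree := by
    intro j v hv
    rw [mem_twistedFreePart]
    intro _
    rw [sub_zero]
    exact F.augmentation_mem j v hv
  have hker : LinearMap.ker F.augmentationToFree = LinearMap.range (F.differential 0) := by
    rw [← LinearMap.exact_iff.1 F.exact_zero]
    ext v
    simp [augmentationToFree, LinearMap.mem_ker, funext_iff]
  have hrange : LinearMap.range F.augmentationToFree = idealSubmodule I := by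
    ext v
    rw [mem_idealSubmodule]
    constructor
    · rintro ⟨w, rfl⟩
      exact (F.augmentation w).2
    · intro hv
      obtain ⟨w, hw⟩ := F.augmentation_surjective ⟨v 0, hv⟩
      refine ⟨w, ?_⟩
      ext1 k
      rw [Fin.fin_one_eq_zero k]
      simp [augmentationToFree, hw]
  have hmin : LinearMap.ker F.augmentationToFree ≤ irrelevantIdeal V K • ⊤ := by
    rw [hker]; exact F.minimal 0
  rw [← hrange]
  cases p with
  | zero => exact hgr.isKoszulAcyclicAt_range_zero_iff hmin
  | succ p =>
    rw [hgr.isKoszulAcyclicAt_range_succ_iff hmin, hker,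
      F.isKoszulAcyclicAt_range_differential, show 0 + 1 + p = p + 1 by omega]

end Resolutions

/-! ### Existence of minimal graded free resolutions -/

section Existence

set_option linter.unusedSectionVars false

variable {V : Type*} [LinearOrder V] [Fintype V] {K : Type*} [Field K] {r s : ℕ}

/-- Homogeneous submodules of a graded free module. -/
def IsHomogeneousSubmodule (ε : Fin s → ℤ)
    (N : Submodule (MvPolynomial V K) (Fin s → MvPolynomial V K)) : Prop :=
  ∀ j, ∀ v ∈ N, freeComponent ε j v ∈ N

/-- Homogeneous generating families with `n` members. -/
def HasHomogeneousGenerators (ε : Fin s → ℤ)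
    (N : Submodule (MvPolynomial V K) (Fin s → MvPolynomial V K)) (n : ℕ) : Prop :=
  ∃ (δ : Fin n → ℤ) (g : Fin n → Fin s → MvPolynomial V K),
    (∀ k, g k ∈ twistedFreePart ε (δ k)) ∧ Submodule.span (MvPolynomial V K) (Set.range g) = N

theorem exists_hasHomogeneousGenerators {ε : Fin s → ℤ}
    {N : Submodule (MvPolynomial V K) (Fin s → MvPolynomial V K)}
    (hN : IsHomogeneousSubmodule ε N) : ∃ n, HasHomogeneousGenerators ε N n := by
  classical
  obtain ⟨S, hS⟩ := IsNoetherian.noetherian N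
  choose t ht using fun v : Fin s → MvPolynomial V K => exists_sum_freeComponent ε v
  set T : Finset (Fin s → MvPolynomial V K) :=
    S.biUnion fun v => (t v).image fun j => freeComponent ε j v with hT
  have hTmem : ∀ w ∈ T, ∃ v ∈ S, ∃ j, freeComponent ε j v = w := by
    intro w hw
    simp only [hT, Finset.mem_biUnion, Finset.mem_image] at hw
    obtain ⟨v, hv, j, -, rfl⟩ := hw
    exact ⟨v, hv, j, rfl⟩
  choose! v hv d hd using hTmem
  refine ⟨T.card, fun k => d (T.equivFin.symm k), fun k => (T.equivFin.symm k : _), fun k => ?_, ?_⟩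
  · have key : ∀ w ∈ T, w ∈ twistedFreePart ε (d w) := fun w hw => by
      have := freeComponent_mem ε (d w) (v w)
      rwa [hd w hw] at this
    exact key _ (T.equivFin.symm k).2
  · have hr : Set.range (fun k => ((T.equivFin.symm k : T) : Fin s → MvPolynomial V K)) = T := by
      ext w
      constructor
      · rintro ⟨k, rfl⟩; exact (T.equivFin.symm k).2
      · intro hw; exact ⟨T.equivFin ⟨w, hw⟩, by simp⟩
    rw [hr]
    refine le_antisymm (Submodule.span_le.2 fun w hw => ?_) ?_
    · rw [← hd w hw]
      refine hN _ _ ?_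
      rw [← hS]
      exact Submodule.subset_span (hv w hw)
    · rw [← hS]
      refine Submodule.span_le.2 fun w hw => ?_
      rw [← ht w (t w) le_rfl]
      refine Submodule.sum_mem _ fun j hj => Submodule.subset_span ?_
      simp only [hT, Finset.coe_biUnion, Finset.coe_image, Set.mem_iUnion, Set.mem_image]
      exact ⟨w, hw, j, hj, rfl⟩

theorem IsGradedHom.isHomogeneousSubmodule_ker {δ : Fin r → ℤ} {ε : Fin s → ℤ}
    {φ : (Fin r → MvPolynomial V K) →ₗ[MvPolynomial V K] (Fin s → MvPolynomial V K)}
    (h : IsGradedHom δ ε φ) : IsHomogeneousSubmodule δ (LinearMap.ker φ) := by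
  intro j v hv
  rw [LinearMap.mem_ker] at *
  rw [h.map_freeComponent, hv, map_zero]

/-- A homogeneous generating family of least size works: a syzygy with a nonzero constant
coefficient would make one generator redundant. -/
theorem exists_minimal_gradedHom {ε : Fin s → ℤ}
    {N : Submodule (MvPolynomial V K) (Fin s → MvPolynomial V K)}
    (hN : IsHomogeneousSubmodule ε N) : ∃ (r : ℕ) (δ : Fin r → ℤ)
      (φ : (Fin r → MvPolynomial V K) →ₗ[MvPolynomial V K] (Fin s → MvPolynomial V K)),
      IsGradedHom δ ε φ ∧ LinearMap.range φ = N ∧ LinearMap.ker φ ≤ irrelevantIdeal V K • ⊤ := by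
  classical
  have hex := exists_hasHomogeneousGenerators hN
  obtain ⟨n, ⟨δ, g, hg, hspan⟩, hmin⟩ : ∃ n, HasHomogeneousGenerators ε N n ∧
      ∀ m < n, ¬ HasHomogeneousGenerators ε N m :=
    ⟨Nat.find hex, Nat.find_spec hex, fun m hm => Nat.find_min hex hm⟩
  have hgr : IsGradedHom δ ε (Fintype.linearCombination (MvPolynomial V K) g) := by
    intro j v hv
    rw [Fintype.linearCombination_apply]
    refine Submodule.sum_mem _ fun k _ => ?_
    rw [mem_twistedFreePart] at *
    intro l
    have := mul_mem_homogeneousPart (hv k) (mem_twistedFreePart.1 (hg k) l)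
    rwa [sub_add_sub_cancel] at this
  refine ⟨n, δ, _, hgr, by rw [Fintype.range_linearCombination, hspan], fun v hv => ?_⟩
  rw [mem_irrelevantIdeal_smul_top_iff]
  intro k
  by_contra hk
  obtain ⟨m, rfl⟩ : ∃ m, n = m + 1 := ⟨n - 1, by have := k.pos; omega⟩
  have hw := hgr.isHomogeneousSubmodule_ker (δ k) v hv
  -- In this degree the `k`-th coordinate of the syzygy is exactly its constant term, a unit, so `g
  -- k` can be solved for.
  set w := freeComponent δ (δ k) v with hw_def
  have hwk : w k = C (constantCoeff (v k)) := by
    ext β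
    rw [hw_def, freeComponent_apply, coeff_polynomialComponent, coeff_C, sub_self,
      constantCoeff_eq]
    by_cases hβ : 0 = β
    · subst hβ; simp
    · rw [if_neg hβ, if_neg]
      intro h
      exact hβ ((Finsupp.degree_eq_zero_iff β).1 (by exact_mod_cast h)).symm
  rw [LinearMap.mem_ker, Fintype.linearCombination_apply, Fin.sum_univ_succAbove _ k, hwk] at hw
  have hgk : g k ∈ Submodule.span (MvPolynomial V K) (Set.range fun l => g (k.succAbove l)) := by
    have e : g k = (C (constantCoeff (v k))⁻¹ : MvPolynomial V K) • -(∑ l, w (k.succAbove l) • g (k.succAbove l)) := by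
      rw [← eq_neg_of_add_eq_zero_left hw, ← mul_smul, ← C_mul, inv_mul_cancel₀ hk, C_1, one_smul]
    rw [e]
    refine Submodule.smul_mem _ _ (Submodule.neg_mem _ (Submodule.sum_mem _ fun l _ =>
      Submodule.smul_mem _ _ (Submodule.subset_span ⟨l, rfl⟩)))
  refine hmin m (Nat.lt_succ_self m) ⟨fun l => δ (k.succAbove l), fun l => g (k.succAbove l),
    fun l => hg _, le_antisymm ?_ ?_⟩
  · rw [← hspan]
    refine Submodule.span_mono ?_
    rintro _ ⟨l, rfl⟩
    exact ⟨_, rfl⟩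
  · rw [← hspan]
    refine Submodule.span_le.2 ?_
    rintro _ ⟨l, rfl⟩
    rcases Fin.eq_self_or_eq_succAbove k l with h | ⟨l', h⟩
    · rw [h]; exact hgk
    · rw [h]; exact Submodule.subset_span ⟨l', rfl⟩

variable (V K) in
/-- A homogeneous submodule of some graded free module. -/
structure GradedSubmodule where
  rank : ℕ
  shift : Fin rank → ℤ
  carrier : Submodule (MvPolynomial V K) (Fin rank → MvPolynomial V K)
  homogeneous : IsHomogeneousSubmodule shift carrier

namespace GradedSubmodule

variable (P : GradedSubmodule V K)

/-- The rank of a minimal graded cover. -/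
def coverRank : ℕ := (exists_minimal_gradedHom P.homogeneous).choose

/-- The degrees of the generators of a minimal graded cover. -/
def coverShift : Fin P.coverRank → ℤ := (exists_minimal_gradedHom P.homogeneous).choose_spec.choose

/-- A minimal graded cover. -/
def cover : (Fin P.coverRank → MvPolynomial V K) →ₗ[MvPolynomial V K]
    (Fin P.rank → MvPolynomial V K) :=
  (exists_minimal_gradedHom P.homogeneous).choose_spec.choose_spec.choose

theorem cover_spec : IsGradedHom P.coverShift P.shift P.cover ∧
    LinearMap.range P.cover = P.carrier ∧ LinearMap.ker P.cover ≤ irrelevantIdeal V K • ⊤ :=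
  (exists_minimal_gradedHom P.homogeneous).choose_spec.choose_spec.choose_spec

/-- The syzygies of the minimal graded cover. -/
def syzygy : GradedSubmodule V K :=
  ⟨P.coverRank, P.coverShift, LinearMap.ker P.cover, P.cover_spec.1.isHomogeneousSubmodule_ker⟩

/-- Iterated syzygies. -/
def syzygies : ℕ → GradedSubmodule V K
  | 0 => P
  | i + 1 => (syzygies i).syzygy

/-- The minimal graded cover of the syzygies. -/
def syzygyCover : (Fin P.syzygy.coverRank → MvPolynomial V K) →ₗ[MvPolynomial V K]
    (Fin P.coverRank → MvPolynomial V K) := P.syzygy.cover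

theorem range_syzygyCover : LinearMap.range P.syzygyCover = LinearMap.ker P.cover :=
  P.syzygy.cover_spec.2.1

theorem exact_syzygyCover : Function.Exact P.syzygy.syzygyCover P.syzygyCover :=
  LinearMap.exact_iff.2 P.syzygy.range_syzygyCover.symm

theorem range_syzygyCover_le : LinearMap.range P.syzygyCover ≤ irrelevantIdeal V K • ⊤ := by
  rw [range_syzygyCover]; exact P.cover_spec.2.2

end GradedSubmodule

/-- An ideal as a homogeneous submodule of the free module of rank one. -/
def idealGradedSubmodule {I : Ideal (MvPolynomial V K)}
    (hI : IsHomogeneousSubmodule (fun _ => 0) (idealSubmodule I)) : GradedSubmodule V K :=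
  ⟨1, fun _ => 0, idealSubmodule I, hI⟩

/-- The minimal graded cover of an ideal. -/
def idealCover {I : Ideal (MvPolynomial V K)}
    (hI : IsHomogeneousSubmodule (fun _ => 0) (idealSubmodule I)) :
    (Fin (idealGradedSubmodule hI).coverRank → MvPolynomial V K) →ₗ[MvPolynomial V K]
      (Fin 1 → MvPolynomial V K) := (idealGradedSubmodule hI).cover

theorem exists_minimalGradedFreeResolution {I : Ideal (MvPolynomial V K)}
    (hI : IsHomogeneousSubmodule (fun _ => 0) (idealSubmodule I)) :
    Nonempty (MinimalGradedFreeResolution (σ := V) (idealPart I)) := by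
  have hrange : LinearMap.range (idealCover hI) = idealSubmodule I :=
    (idealGradedSubmodule hI).cover_spec.2.1
  have hmem : ∀ v, idealCover hI v 0 ∈ I := fun v => by
    have := LinearMap.mem_range_self (idealCover hI) v
    rw [hrange] at this
    exact mem_idealSubmodule.1 this
  let aug : (Fin (idealGradedSubmodule hI).coverRank → MvPolynomial V K) →ₗ[MvPolynomial V K] I :=
    LinearMap.codRestrict I
      ((LinearMap.proj 0 : (Fin 1 → MvPolynomial V K) →ₗ[MvPolynomial V K] _) ∘ₗ idealCover hI) hmem
  have haug : ∀ v, (aug v : MvPolynomial V K) = idealCover hI v 0 := fun _ => rfl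
  have hsurj : Function.Surjective aug := fun f => by
    have : (fun _ => f : Fin 1 → MvPolynomial V K) ∈ LinearMap.range (idealCover hI) := by
      rw [hrange]; exact mem_idealSubmodule.2 f.2
    obtain ⟨v, hv⟩ := this
    exact ⟨v, Subtype.ext (congr_fun hv 0)⟩
  have hgr : ∀ (j : ℤ), ∀ v ∈ twistedFreePart (K := K) (idealGradedSubmodule hI).coverShift j,
      aug v ∈ idealPart I j := fun j v hv => by
    have := mem_twistedFreePart.1 ((idealGradedSubmodule hI).cover_spec.1 j v hv) (0 : Fin 1)
    rw [show (idealGradedSubmodule hI).shift (0 : Fin 1) = 0 from rfl, sub_zero] at this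
    exact this
  have hexact : Function.Exact (idealGradedSubmodule hI).syzygyCover aug := by
    rw [LinearMap.exact_iff, GradedSubmodule.range_syzygyCover]
    change _ = LinearMap.ker (idealCover hI)
    ext v
    rw [LinearMap.mem_ker, LinearMap.mem_ker, Subtype.ext_iff, haug]
    constructor
    · intro h
      ext1 k
      rw [Fin.fin_one_eq_zero k]
      exact h
    · intro h
      exact congr_fun h 0
  exact ⟨{
    rank := fun i => ((idealGradedSubmodule hI).syzygies i).coverRank
    shift := fun i => ((idealGradedSubmodule hI).syzygies i).coverShift
    augmentation := aug
    differential := fun i => ((idealGradedSubmodule hI).syzygies i).syzygyCover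
    augmentation_mem := hgr
    differential_mem := fun i => ((idealGradedSubmodule hI).syzygies i).syzygy.cover_spec.1
    augmentation_surjective := hsurj
    exact_zero := hexact
    exact_succ := fun i => ((idealGradedSubmodule hI).syzygies i).exact_syzygyCover
    minimal := fun i => ((idealGradedSubmodule hI).syzygies i).range_syzygyCover_le }⟩

end Existence

/-! ### Regularity in the extended reals -/

section RegularityOfMonomialIdeals

set_option linter.unusedSectionVars false

variable {V : Type*} [LinearOrder V] [Fintype V] {K : Type*} [Field K]
  {I J : Ideal (MvPolynomial V K)} {S : Set (V →₀ ℕ)}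

theorem isHomogeneousSubmodule_idealSubmodule (hI : ∀ f, f ∈ I ↔ ∀ β, coeff β f ≠ 0 → β ∈ S) :
    IsHomogeneousSubmodule (fun _ => 0) (idealSubmodule I) := by
  intro j v hv
  rw [mem_idealSubmodule, hI] at *
  intro β hβ
  rw [freeComponent_apply, coeff_polynomialComponent] at hβ
  refine hv β fun h => hβ ?_
  simp [h]

/-- The regularity of a monomial ideal in terms of its upper Koszul complexes. -/
theorem reg_le_iff_monomialRegLE (hI : ∀ f, f ∈ I ↔ ∀ β, coeff β f ≠ 0 → β ∈ S) (r : ℤ) :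
    reg I ≤ ((r : ℝ) : EReal) ↔ MonomialRegLE K S r := by
  have hbetti : ∀ (F : MinimalGradedFreeResolution (σ := V) (idealPart I)) (i : ℕ) (j : ℤ),
      F.betti i j ≠ 0 ↔ ∃ k, F.shift i k = j := by
    intro F i j
    rw [MinimalGradedFreeResolution.betti, ← Nat.pos_iff_ne_zero, Fintype.card_pos_iff, nonempty_subtype]
  rw [reg, moduleRegularity, sSup_le_iff]
  constructor
  · intro h α i hi
    -- Without an existing resolution the supremum would be over the empty set and the bound would
    -- carry no information.
    obtain ⟨F⟩ := exists_minimalGradedFreeResolution (isHomogeneousSubmodule_idealSubmodule hI)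
    refine (isKoszulAcyclicAt_idealSubmodule_iff hI).1
      ((F.isKoszulAcyclicAt_iff i α.degree).2 fun k hk => ?_) α rfl
    have h1 := h _ ⟨F, i, α.degree, (hbetti F i _).2 ⟨k, hk⟩, rfl⟩
    have h2 : ((α.degree : ℤ) - i : ℤ) ≤ r := by exact_mod_cast h1
    omega
  · rintro h _ ⟨F, i, j, hb, rfl⟩
    obtain ⟨k, hk⟩ := (hbetti F i j).1 hb
    have h1 : j - i ≤ r := by
      by_contra! h'
      refine (F.isKoszulAcyclicAt_iff i j).1 ((isKoszulAcyclicAt_idealSubmodule_iff hI).2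
        fun α hα => h α i (by omega)) k hk
    exact_mod_cast h1

theorem reg_le_floor {x : ℝ} (h : reg I ≤ (x : EReal)) : reg I ≤ ((⌊x⌋ : ℝ) : EReal) := by
  refine sSup_le ?_
  rintro y hy
  have h1 : y ≤ (x : EReal) := (le_sSup hy).trans h
  obtain ⟨F, i, j, -, rfl⟩ := hy
  have h2 : ((j - i : ℤ) : ℝ) ≤ x := by exact_mod_cast h1
  have h3 := Int.le_floor.2 h2
  exact_mod_cast h3

/-- Integer bounds suffice because regularity is a supremum of integers. If `reg I = ⊥`, arbitrarily
negative bounds force `reg J = ⊥`. -/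
theorem reg_le_reg_add {n : ℤ} (h : ∀ r : ℤ, reg I ≤ ((r : ℝ) : EReal) →
    reg J ≤ (((r + n : ℤ) : ℝ) : EReal)) : reg J ≤ reg I + ((n : ℝ) : EReal) := by
  by_cases htop : reg I = ⊤
  · rw [htop, EReal.top_add_coe]; exact le_top
  by_cases hbot : reg I = ⊥
  · rw [hbot, EReal.bot_add, le_bot_iff, EReal.eq_bot_iff_forall_lt]
    intro y
    have h1 := h (⌊y⌋ - 1 - n) (by rw [hbot]; exact bot_le)
    refine h1.trans_lt ?_
    rw [EReal.coe_lt_coe_iff]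
    have := Int.floor_le y
    push_cast
    linarith
  · obtain ⟨x, hx⟩ : ∃ x : ℝ, reg I = x := ⟨(reg I).toReal, (EReal.coe_toReal htop hbot).symm⟩
    refine (h _ (reg_le_floor hx.le)).trans ?_
    rw [hx, ← EReal.coe_add, EReal.coe_le_coe_iff]
    have := Int.floor_le x
    push_cast
    linarith

end RegularityOfMonomialIdeals

/-! ### Powers of the edge ideal as monomial ideals, and the main theorem -/

section EdgeIdeals

variable {V : Type*} {K : Type*} [Field K]

theorem edgeIdeal_pow_eq_span (G : SimpleGraph V) (s : ℕ) :
    edgeIdeal K G ^ s =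
      Ideal.span ((fun γ => monomial γ (1 : K)) '' {γ | IsEdgeProduct G s γ}) := by
  induction s with
  | zero =>
    rw [pow_zero, Ideal.one_eq_top, eq_comm, Ideal.eq_top_iff_one]
    exact Ideal.subset_span ⟨0, .zero, rfl⟩
  | succ s ih =>
    rw [pow_succ, ih, edgeIdeal, Ideal.span_mul_span']
    congr 1
    ext f
    have e : ∀ (γ : V →₀ ℕ) (u v : V), monomial γ (1 : K) * (X u * X v) =
        monomial (γ + Finsupp.single u 1 + Finsupp.single v 1) 1 := by
      intro γ u v
      rw [X, X, monomial_mul, monomial_mul, one_mul, one_mul, add_assoc]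
    constructor
    · rintro ⟨_, ⟨γ, hγ, rfl⟩, _, ⟨u, v, huv, rfl⟩, rfl⟩
      exact ⟨_, IsEdgeProduct.succ hγ huv, (e γ u v).symm⟩
    · rintro ⟨γ, hγ, rfl⟩
      obtain ⟨u, v, δ, huv, hδ, rfl⟩ := IsEdgeProduct.exists_of_succ hγ
      exact ⟨_, ⟨δ, hδ, rfl⟩, _, ⟨u, v, huv, rfl⟩, e δ u v⟩

theorem mem_edgeIdeal_pow_iff (G : SimpleGraph V) (s : ℕ) (f : MvPolynomial V K) :
    f ∈ edgeIdeal K G ^ s ↔ ∀ β, coeff β f ≠ 0 → β ∈ edgePowerSet G s := by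
  rw [edgeIdeal_pow_eq_span, mem_ideal_span_monomial_image]
  simp only [mem_support_iff]
  rfl

end EdgeIdeals

end EdgeIdealPowers

end

open EdgeIdealPowers in
theorem reg_edgeIdeal_pow_le_iff {V : Type*} [LinearOrder V] [Fintype V] (K : Type*) [Field K]
    (G : SimpleGraph V) (s : ℕ) (r : ℤ) :
    reg (edgeIdeal K G ^ s) ≤ ((r : ℝ) : EReal) ↔ MonomialRegLE K (edgePowerSet G s) r :=
  reg_le_iff_monomialRegLE (mem_edgeIdeal_pow_iff G s) r

open EdgeIdealPowers in
theorem reg_edgeIdeal_pow_le {V : Type*} [LinearOrder V] [Fintype V] (K : Type*) [Field K]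
    (G : SimpleGraph V) {s : ℕ} (hs : 1 ≤ s) (h : s = 2 ∨ G.IsBipartite) :
    reg (edgeIdeal K G ^ s) ≤ reg (edgeIdeal K G) + (((2 * s - 2 : ℤ) : ℝ) : EReal) := by
  refine reg_le_reg_add fun r hr => ?_
  rw [← pow_one (edgeIdeal K G), reg_edgeIdeal_pow_le_iff] at hr
  rw [reg_edgeIdeal_pow_le_iff]
  obtain ⟨s, rfl⟩ := Nat.exists_eq_add_of_le' hs
  by_cases hG : ∃ a b, G.Adj a b
  · obtain ⟨a, b, hab⟩ := hG
    have hr2 : 2 ≤ r := by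
      simpa using two_mul_le_of_monomialRegLE (IsEdgeProduct.zero.succ hab) hr
    rcases h with h | h
    · obtain rfl : s = 1 := by omega
      exact hr.edgePowerSet_two hab
    · obtain ⟨κ⟩ := h
      have hκ : ∀ u v, G.Adj u v → (decide (κ u = 0)) ≠ decide (κ v = 0) := by
        intro u v huv
        have := κ.valid huv
        rw [ne_eq, decide_eq_decide]
        omega
      have := hr.edgePowerSet_of_bipartite hκ (by omega) s
      convert this using 1
      push_cast; ring
  · push Not at hG
    exact monomialRegLE_edgePowerSet_of_forall_not_adj hG s _

theorem theorem1p1 {V : Type*} [Finite V] (K : Type*) [Field K] (G : SimpleGraph V) :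
    EdgeIdealPowers.reg (EdgeIdealPowers.edgeIdeal K G ^ 2)
        ≤ EdgeIdealPowers.reg (EdgeIdealPowers.edgeIdeal K G) + 2 ∧
    (G.IsBipartite →
      (∀ s : ℕ, 2 ≤ s →
        EdgeIdealPowers.reg (EdgeIdealPowers.edgeIdeal K G ^ s)
          ≤ 2 * (s : EReal) + EdgeIdealPowers.reg (EdgeIdealPowers.edgeIdeal K G) - 2) ∧
      (∀ a b : ℤ,
        EdgeIdealPowers.HasAsymptoticRegularity (EdgeIdealPowers.edgeIdeal K G) a b →
          ((b : ℝ) : EReal) ≤ EdgeIdealPowers.reg (EdgeIdealPowers.edgeIdeal K G) - 2)) := by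
  classical
  cases nonempty_fintype V
  -- An arbitrary order on the vertices, used only for signs and for the lexicographic order.
  let _ : LinearOrder V := linearOrderOfSTO (WellOrderingRel : V → V → Prop)
  refine ⟨?_, fun hG => ⟨fun s hs => ?_, fun a b ⟨c, hc⟩ => ?_⟩⟩
  · convert reg_edgeIdeal_pow_le K G (s := 2) (by norm_num) (Or.inl rfl) using 2
    norm_num
    rfl
  · refine (reg_edgeIdeal_pow_le K G (by omega) (Or.inr hG)).trans_eq ?_
    have e2 : (2 : EReal) = ((2 : ℝ) : EReal) := rfl
    have es : (s : EReal) = ((s : ℝ) : EReal) := rfl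
    rw [e2, es, ← EReal.coe_mul]
    induction EdgeIdealPowers.reg (EdgeIdealPowers.edgeIdeal K G) with
    | bot => simp
    | top => rw [EReal.top_add_coe, EReal.coe_add_top, EReal.top_sub_coe]
    | coe x =>
      rw [← EReal.coe_add, ← EReal.coe_add, ← EReal.coe_sub, EReal.coe_eq_coe_iff]
      push_cast
      ring
  · have hupper : ∀ k : ℕ, c ≤ k → 1 ≤ k → (((a * k + b : ℤ) : ℝ) : EReal) ≤
        EdgeIdealPowers.reg (EdgeIdealPowers.edgeIdeal K G) + (((2 * k - 2 : ℤ) : ℝ) : EReal) :=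
      fun k hk h1 => (hc k hk).symm.trans_le (reg_edgeIdeal_pow_le K G h1 (Or.inr hG))
    -- I^k has a generator of degree 2k. Without edges I^k is zero, and its regularity `⊥`
    -- contradicts the finite value in the hypothesis.
    have hlower : ∀ k : ℕ, c ≤ k → 1 ≤ k → 2 * (k : ℤ) ≤ a * k + b := by
      intro k hk h1
      by_cases hE : ∃ u v, G.Adj u v
      · obtain ⟨u, v, huv⟩ := hE
        have hprod : ∀ m : ℕ, ∃ γ, EdgeIdealPowers.IsEdgeProduct G m γ := by
          intro m
          induction m with
          | zero => exact ⟨0, .zero⟩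
          | succ m ih => obtain ⟨γ, hγ⟩ := ih; exact ⟨_, hγ.succ huv⟩
        obtain ⟨γ, hγ⟩ := hprod k
        exact EdgeIdealPowers.two_mul_le_of_monomialRegLE hγ
          ((reg_edgeIdeal_pow_le_iff K G k _).1 (hc k hk).le)
      · push Not at hE
        obtain ⟨m, rfl⟩ := Nat.exists_eq_add_of_le' h1
        have h2 := (reg_edgeIdeal_pow_le_iff K G (m + 1) (a * ((m + 1 : ℕ) : ℤ) + b - 1)).2
          (EdgeIdealPowers.monomialRegLE_edgePowerSet_of_forall_not_adj hE m _)
        rw [hc _ hk, EReal.coe_le_coe_iff] at h2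
        have h3 : a * ((m + 1 : ℕ) : ℤ) + b ≤ a * ((m + 1 : ℕ) : ℤ) + b - 1 := by exact_mod_cast h2
        omega
    have ha : 2 ≤ a := by
      by_contra! ha
      -- If a ≤ 1, the lower bound gives k ≤ b, which fails for this k because it is at least b + 1.
      have h1 := hlower (max c 1 + b.toNat) (by omega) (by omega)
      have h2 : (b.toNat : ℤ) ≥ b := Int.self_le_toNat b
      have h3 : ((max c 1 + b.toNat : ℕ) : ℤ) ≥ 1 + b := by push_cast; omega
      nlinarith
    have h := hupper (max c 1) (le_max_left _ _) (le_max_right _ _)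
    have e2 : (2 : EReal) = ((2 : ℝ) : EReal) := rfl
    rw [e2]
    revert h
    induction EdgeIdealPowers.reg (EdgeIdealPowers.edgeIdeal K G) with
    | bot =>
      intro h
      rw [EReal.bot_add, le_bot_iff] at h
      exact absurd h (EReal.coe_ne_bot _)
    | top => intro _; rw [EReal.top_sub_coe]; exact le_top
    | coe x =>
      rw [← EReal.coe_add, ← EReal.coe_sub, EReal.coe_le_coe_iff, EReal.coe_le_coe_iff]
      intro h
      have ha' : (2 : ℝ) ≤ a := by exact_mod_cast ha
      have hk : (0 : ℝ) ≤ ((max c 1 : ℕ) : ℝ) := Nat.cast_nonneg _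
      push_cast at h hk
      nlinarith
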